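/- Let $(M,m,V)$ be a natural mechanical system: $M$ is a smooth (finite-dimensional, boundaryless) manifold, $m=\langle\cdot,\cdot\rangle$ a smooth Riemannian metric and $V$ a smooth function on $M$. Let $p_M:T(M)\to M$ be the tangent bundle projection, $K(w)=\frac12\langle w,w\rangle$, $H=K+V\circ p_M$, let $\theta$ be the $1$-form $\theta_w(Y)=\langle w,Tp_M(Y)\rangle$ on $T(M)$ and $\sigma=d\theta$. Let the one-parameter group $G=\{g^\tau\}_{\tau\in\mathbb R}$ (a line or a circle) act on $M$ by diffeomorphisms that preserve $m$ and $V$, so that $p:M\to\tilde M=M/G$ is a smooth principal $G$-bundle. Let $v(x)=\frac{d}{d\tau}\big|_{\tau=0}g^\tau(x)$, $J(w)=\langle v,w\rangle$ for $w\in T(M)$, and for $k\in\mathbb R$ let $J_k=J^{-1}(k)\subset T(M)$ and $\rho_k=Tp|_{J_k}:J_k\to T(\tilde M)$. Then $J$ is everywhere regular, there is a unique vector field $X$ on $T(M)$ with $i_X\sigma=-dH$, it is smooth and tangent to $J_k$, and: (i) there are a unique smooth Riemannian metric $\tilde m$ on $\tilde M$ such that $\tilde m(Tp\,w_1,Tp\,w_2)=\langle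 w_1,w_2\rangle$ for all $w_1,w_2\in T_xM$ orthogonal to $v(x)$, and a unique function $\tilde V_k$ on $\tilde M$ such that $\tilde V_k(p(x))=V(x)+\dfrac{k^2}{2\langle v(x),v(x)\rangle}$; the latter is smooth; (ii) there are a unique $2$-form $\tilde\sigma^k$ on $T(\tilde M)$ with $\rho_k^*\tilde\sigma^k=\sigma|_{J_k}$, a unique vector field $\tilde X_k$ on $T(\tilde M)$ (the reduced system) with $T\rho_k\circ X=\tilde X_k\circ\rho_k$ on $J_k$, and a unique function $\tilde H_k$ on $T(\tilde M)$ (the reduced energy) with $H|_{J_k}=\tilde H_k\circ\rho_k$; all three are smooth; (iii) $\tilde\sigma^k$ is a symplectic form on $T(\tilde M)$, and $\tilde X_k$ is the Hamiltonian field on $(T(\tilde M),\tilde\sigma^k)$ with Hamilton function $\tilde H_k$, i.e. $i_{\tilde X_k}\tilde\sigma^k=-d\tilde H_k$; (iv) $\tilde H_k=\tilde K+\tilde V_k\circ p_{\tilde M}$, where $\tilde K(\tilde w)=\frac12\tilde m(\tilde w,\tilde w)$ and $p_{\tilde M}:T(\tilde M)\to\tilde M$ is the projection. -/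

import Mathlib

open scoped Manifold ContDiff
open Set

noncomputable section

/-! ### Differential forms on manifolds -/

section Forms

variable {E : Type*} [NormedAddCommGroup E] [NormedSpace ℝ E]
  {H : Type*} [TopologicalSpace H]
  {E' : Type*} [NormedAddCommGroup E'] [NormedSpace ℝ E']
  {H' : Type*} [TopologicalSpace H']

/-- (Not necessarily smooth) differential `n`-forms on the manifold `N`. -/
abbrev DiffForm (I : ModelWithCorners ℝ E H) (N : Type*) [TopologicalSpace N]
    [ChartedSpace H N] (n : ℕ) :=
  (x : N) → TangentSpace I x [⋀^Fin n]→L[ℝ] ℝ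

namespace DiffForm

/-- The coordinate expression of `α` in the preferred chart around `x₀`, i.e. the pullback of `α`
under the inverse of the chart, a form on (the target of the chart in) the model vector space. -/
def inChart (I : ModelWithCorners ℝ E H) {N : Type*} [TopologicalSpace N] [ChartedSpace H N]
    {n : ℕ} (α : DiffForm I N n) (x₀ : N) (y : E) : E [⋀^Fin n]→L[ℝ] ℝ :=
  (α ((extChartAt I x₀).symm y)).compContinuousLinearMap
    (mfderivWithin 𝓘(ℝ, E) I (extChartAt I x₀).symm (range I) y :
      E →L[ℝ] TangentSpace I ((extChartAt I x₀).symm y))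

/-- A form is smooth if its coordinate expressions are smooth. -/
def IsSmooth (I : ModelWithCorners ℝ E H) {N : Type*} [TopologicalSpace N] [ChartedSpace H N]
    {n : ℕ} (α : DiffForm I N n) : Prop :=
  ∀ x₀ : N, ContDiffOn ℝ ∞ (inChart I α x₀) (extChartAt I x₀).target

/-- The exterior derivative: at `x`, the exterior derivative of the coordinate expression of the
form in the chart around `x`, transported back to the manifold. -/
def d (I : ModelWithCorners ℝ E H) {N : Type*} [TopologicalSpace N] [ChartedSpace H N]
    {n : ℕ} (α : DiffForm I N n) : DiffForm I N (n + 1) := fun x =>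
  (extDerivWithin (inChart I α x) (range I) (extChartAt I x x)).compContinuousLinearMap
    (mfderiv I 𝓘(ℝ, E) (extChartAt I x) x : TangentSpace I x →L[ℝ] E)

/-- The pullback of a form under a map. -/
def pullback (I : ModelWithCorners ℝ E H) (I' : ModelWithCorners ℝ E' H')
    {N : Type*} [TopologicalSpace N] [ChartedSpace H N]
    {N' : Type*} [TopologicalSpace N'] [ChartedSpace H' N'] {n : ℕ} (f : N → N')
    (α : DiffForm I' N' n) : DiffForm I N n := fun x =>
  (α (f x)).compContinuousLinearMap (mfderiv I I' f x)

/-- A symplectic form: a smooth closed nondegenerate `2`-form. -/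
structure IsSymplectic (I : ModelWithCorners ℝ E H) {N : Type*} [TopologicalSpace N]
    [ChartedSpace H N] (α : DiffForm I N 2) : Prop where
  smooth : IsSmooth I α
  closed : d I α = 0
  nondegenerate : ∀ (x : N) (u : TangentSpace I x),
    (∀ u' : TangentSpace I x, α x ![u, u'] = 0) → u = 0

end DiffForm

/-- The differential of a real function at a point, as a linear form. -/
def diffAt (I : ModelWithCorners ℝ E H) {N : Type*} [TopologicalSpace N] [ChartedSpace H N]
    (f : N → ℝ) (x : N) : TangentSpace I x →L[ℝ] ℝ :=
  mfderiv I 𝓘(ℝ, ℝ) f x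

/-- Smooth vector fields. -/
def IsSmoothField (I : ModelWithCorners ℝ E H) {N : Type*} [TopologicalSpace N]
    [ChartedSpace H N] [IsManifold I 1 N] (X : (x : N) → TangentSpace I x) : Prop :=
  ContMDiff I I.tangent ∞ (fun x => (⟨x, X x⟩ : TangentBundle I N))

/-- `X` is the Hamiltonian field of the function `h` with respect to `α`: `i_X α = - dh`. -/
def IsHamiltonianField (I : ModelWithCorners ℝ E H) {N : Type*} [TopologicalSpace N]
    [ChartedSpace H N] (α : DiffForm I N 2) (h : N → ℝ) (X : (x : N) → TangentSpace I x) : Prop :=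
  ∀ (x : N) (u : TangentSpace I x), α x ![X x, u] = - diffAt I h x u

end Forms

/-! ### Natural mechanical systems -/

section Natural

variable {E : Type*} [NormedAddCommGroup E] [NormedSpace ℝ E]
  {M : Type*} [TopologicalSpace M] [ChartedSpace E M] [IsManifold 𝓘(ℝ, E) ∞ M]

variable (E M) in
/-- Smooth Riemannian metrics on `M`. -/
abbrev RiemMetric :=
  Bundle.ContMDiffRiemannianMetric 𝓘(ℝ, E) ∞ E (fun x : M => TangentSpace 𝓘(ℝ, E) x)

/-- The kinetic energy `K(w) = ⟨w, w⟩ / 2` on the tangent bundle. -/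
def kineticEnergy (m : RiemMetric E M) (w : TangentBundle 𝓘(ℝ, E) M) : ℝ :=
  (1 / 2) * m.inner w.proj w.2 w.2

/-- The total energy `H = K + V ∘ p_M`. -/
def totalEnergy (m : RiemMetric E M) (V : M → ℝ) (w : TangentBundle 𝓘(ℝ, E) M) : ℝ :=
  kineticEnergy m w + V w.proj

/-- The Lagrange `1`-form on the tangent bundle: `θ_w(Y) = ⟨w, Tp_M Y⟩`. -/
def lagrangeOneForm (m : RiemMetric E M) :
    DiffForm 𝓘(ℝ, E).tangent (TangentBundle 𝓘(ℝ, E) M) 1 := fun w =>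
  ContinuousAlternatingMap.ofSubsingleton ℝ (TangentSpace 𝓘(ℝ, E).tangent w) ℝ (0 : Fin 1)
    ((m.inner w.proj w.2).comp
      (mfderiv 𝓘(ℝ, E).tangent 𝓘(ℝ, E)
        (fun w' : TangentBundle 𝓘(ℝ, E) M => w'.proj) w))

/-- The Lagrange `2`-form `σ = dθ`. -/
def lagrangeTwoForm (m : RiemMetric E M) :
    DiffForm 𝓘(ℝ, E).tangent (TangentBundle 𝓘(ℝ, E) M) 2 :=
  DiffForm.d 𝓘(ℝ, E).tangent (lagrangeOneForm m)

end Natural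

/-! ### One-parameter symmetry groups and reduction -/

section Symmetry

variable {E : Type*} [NormedAddCommGroup E] [NormedSpace ℝ E]
  {M : Type*} [TopologicalSpace M] [ChartedSpace E M]
  {F : Type*} [NormedAddCommGroup F] [NormedSpace ℝ F]
  {B : Type*} [TopologicalSpace B] [ChartedSpace F B]

variable (E F) in
/-- The one-parameter group `G = {g^τ}` acts smoothly on `M` and `p : M → B` is a (smooth) principal
`G`-bundle with base `B = M / G`.

Here `G` is the Lie group `ℝ / Γ` with `Γ = {τ | g^τ = id}` (so a line or a circle). Given
`locallyTrivial`, the map `U × G → p⁻¹(U)`, `(u, g^τ) ↦ g^τ (s u)`, is `G`-equivariant, and it is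
bijective by `free` and `fiber`; as `ℝ → G` is a covering, this map is a diffeomorphism if and only
if its lift to `U × ℝ` is a local diffeomorphism. -/
structure IsPrincipalFlowBundle (g : ℝ → M → M) (p : M → B) : Prop where
  smooth_action : ContMDiff (𝓘(ℝ, ℝ).prod 𝓘(ℝ, E)) 𝓘(ℝ, E) ∞ (fun q : ℝ × M => g q.1 q.2)
  zero : ∀ x, g 0 x = x
  add : ∀ τ τ' x, g (τ + τ') x = g τ (g τ' x)
  free : ∀ τ x, g τ x = x → ∀ y, g τ y = y
  smooth_proj : ContMDiff 𝓘(ℝ, E) 𝓘(ℝ, F) ∞ p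
  surjective : Function.Surjective p
  fiber : ∀ x y, p x = p y ↔ ∃ τ, g τ x = y
  locallyTrivial : ∀ b : B, ∃ U : Set B, IsOpen U ∧ b ∈ U ∧ ∃ s : B → M,
    ContMDiffOn 𝓘(ℝ, F) 𝓘(ℝ, E) ∞ s U ∧ (∀ u ∈ U, p (s u) = u) ∧
    IsLocalDiffeomorphOn (𝓘(ℝ, F).prod 𝓘(ℝ, ℝ)) 𝓘(ℝ, E) ∞
      (fun q : B × ℝ => g q.2 (s q.1)) (U ×ˢ univ)

variable (E) in
/-- The generating field `v(x) = d/dτ|₀ g^τ(x)`, a tangent vector at `x = g^0(x)`. -/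
def generator (g : ℝ → M → M) (x : M) : TangentSpace 𝓘(ℝ, E) x :=
  (mfderiv 𝓘(ℝ, ℝ) 𝓘(ℝ, E) (fun τ : ℝ => g τ x) 0 : ℝ →L[ℝ] TangentSpace 𝓘(ℝ, E) (g 0 x)) 1

/-- All `g^τ` are isometries of the metric `m`. -/
def PreservesMetric [IsManifold 𝓘(ℝ, E) ∞ M] (m : RiemMetric E M) (g : ℝ → M → M) : Prop :=
  ∀ (τ : ℝ) (x : M) (w₁ w₂ : TangentSpace 𝓘(ℝ, E) x),
    m.inner (g τ x) (mfderiv 𝓘(ℝ, E) 𝓘(ℝ, E) (g τ) x w₁) (mfderiv 𝓘(ℝ, E) 𝓘(ℝ, E) (g τ) x w₂)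
      = m.inner x w₁ w₂

/-- The momentum `J(w) = ⟨v, w⟩`. -/
def momentum [IsManifold 𝓘(ℝ, E) ∞ M] (m : RiemMetric E M) (g : ℝ → M → M)
    (w : TangentBundle 𝓘(ℝ, E) M) : ℝ :=
  m.inner w.proj (generator E g w.proj) w.2

/-- The momentum level `J_k`. -/
def momentumLevel [IsManifold 𝓘(ℝ, E) ∞ M] (m : RiemMetric E M) (g : ℝ → M → M) (k : ℝ) :
    Set (TangentBundle 𝓘(ℝ, E) M) :=
  {w | momentum m g w = k}

/-- The tangent space at `w` of the momentum level through `w`: the kernel of `dJ_w`. -/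
def levelTangentSpace [IsManifold 𝓘(ℝ, E) ∞ M] (m : RiemMetric E M) (g : ℝ → M → M)
    (w : TangentBundle 𝓘(ℝ, E) M) : Set (TangentSpace 𝓘(ℝ, E).tangent w) :=
  {Y | diffAt 𝓘(ℝ, E).tangent (momentum m g) w Y = 0}

/-- `σ'` is the reduced form `σ̃^k` on `T(B)`: its pullback under `ρ_k = Tp|J_k` is the restriction
`σ^k` to `J_k` of the Lagrange form `σ`. -/
def IsReducedForm [IsManifold 𝓘(ℝ, E) ∞ M] [IsManifold 𝓘(ℝ, F) ∞ B]
    (m : RiemMetric E M) (g : ℝ → M → M) (p : M → B) (k : ℝ)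
    (σ' : DiffForm 𝓘(ℝ, F).tangent (TangentBundle 𝓘(ℝ, F) B) 2) : Prop :=
  ∀ w ∈ momentumLevel m g k, ∀ Y₁ ∈ levelTangentSpace m g w, ∀ Y₂ ∈ levelTangentSpace m g w,
    DiffForm.pullback 𝓘(ℝ, E).tangent 𝓘(ℝ, F).tangent (tangentMap 𝓘(ℝ, E) 𝓘(ℝ, F) p) σ' w ![Y₁, Y₂]
      = lagrangeTwoForm m w ![Y₁, Y₂]

/-- `X'` is the reduced system on `T(B)` of the field `X` on `T(M)`: `Tρ_k ∘ X = X' ∘ ρ_k` on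
`J_k`. -/
def IsReducedField [IsManifold 𝓘(ℝ, E) ∞ M] [IsManifold 𝓘(ℝ, F) ∞ B]
    (m : RiemMetric E M) (g : ℝ → M → M) (p : M → B) (k : ℝ)
    (X : (w : TangentBundle 𝓘(ℝ, E) M) → TangentSpace 𝓘(ℝ, E).tangent w)
    (X' : (z : TangentBundle 𝓘(ℝ, F) B) → TangentSpace 𝓘(ℝ, F).tangent z) : Prop :=
  ∀ w ∈ momentumLevel m g k,
    mfderiv 𝓘(ℝ, E).tangent 𝓘(ℝ, F).tangent (tangentMap 𝓘(ℝ, E) 𝓘(ℝ, F) p) w (X w)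
      = X' (tangentMap 𝓘(ℝ, E) 𝓘(ℝ, F) p w)

/-- `H'` is the reduced energy on `T(B)`: `H = H' ∘ ρ_k` on `J_k`. -/
def IsReducedEnergy [IsManifold 𝓘(ℝ, E) ∞ M] [IsManifold 𝓘(ℝ, F) ∞ B]
    (m : RiemMetric E M) (V : M → ℝ) (g : ℝ → M → M) (p : M → B) (k : ℝ)
    (H' : TangentBundle 𝓘(ℝ, F) B → ℝ) : Prop :=
  ∀ w ∈ momentumLevel m g k, totalEnergy m V w = H' (tangentMap 𝓘(ℝ, E) 𝓘(ℝ, F) p w)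

/-- `m'` is the reduced metric on `B`: the map `T_x p` is isometric on the orthogonal complement
of `v(x)`. -/
def IsReducedMetric [IsManifold 𝓘(ℝ, E) ∞ M] [IsManifold 𝓘(ℝ, F) ∞ B]
    (m : RiemMetric E M) (g : ℝ → M → M) (p : M → B) (m' : RiemMetric F B) : Prop :=
  ∀ (x : M) (w₁ w₂ : TangentSpace 𝓘(ℝ, E) x),
    m.inner x (generator E g x) w₁ = 0 → m.inner x (generator E g x) w₂ = 0 →
    m'.inner (p x) (mfderiv 𝓘(ℝ, E) 𝓘(ℝ, F) p x w₁) (mfderiv 𝓘(ℝ, E) 𝓘(ℝ, F) p x w₂)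
      = m.inner x w₁ w₂

/-- `V'` is the amended (effective) potential on `B`. -/
def IsAmendedPotential [IsManifold 𝓘(ℝ, E) ∞ M] (m : RiemMetric E M) (V : M → ℝ)
    (g : ℝ → M → M) (p : M → B) (k : ℝ) (V' : B → ℝ) : Prop :=
  ∀ x : M, V' (p x) = V x + k ^ 2 / (2 * m.inner x (generator E g x) (generator E g x))

end Symmetry

end

/-!
Write `v` for the generating field, `A = ⟨v, ·⟩ / ⟨v, v⟩` for the connection form on `M`, `θ` for the
Lagrange `1`-form, `J` for the momentum, and `m'` for the reduced metric. The transverse form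
`⟨u, w⟩ - ⟨v, u⟩ ⟨v, w⟩ / ⟨v, v⟩` is invariant under the flow and annihilates `v`, so it descends to `m'`
(`exists_reducedMetric`).

Over the domain of a section `s` of `p`, a point near a given one is `g^t (s (p x))` with a smooth flow
time `t`, and invariance of the metric gives `A = dt + (s ∘ p)^* A`. Splitting `⟨w, ·⟩` into its
transverse part and its part along `v` turns this into
`θ = (Tp)^* β + k d(t ∘ p_M) + (J - k) p_M^* A` with `β = θ_{m'} + k (s ∘ p_B)^* A` a smooth `1`-form on
`T(B)` (`IsFlowSection.lagrangeOneForm_eq`). Taking exterior derivatives, the middle term disappears,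
and on the level `J = k` one gets
`σ = (Tp)^* dβ + dJ ∧ p_M^* A` (`IsFlowSection.lagrangeTwoForm_eq`).

All assertions about the reduced form follow from this identity by linear algebra
(`linear_reduction`): since `σ` is nondegenerate (`lagrangeTwoForm_nondegenerate`) and
`dim T(M) = dim T(B) + 2`, the map `(T(Tp), dJ)` is onto, so that `J` is regular, `dβ` is determined by
`σ` and hence independent of the section, and `dβ` is nondegenerate. The forms `dβ` therefore glue to a
form which is smooth and closed because it is locally exact, i.e. to the symplectic reduced form
(`exists_reducedForm`).

The identity `H = H' ∘ Tp + (J² - k²) / (2 ⟨v, v⟩)` (`totalEnergy_eq_add`), where `H'` is the energy of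
the metric `m'` and the amended potential, shows that `dH = (Tp)^* dH'` on the tangent spaces of the
level. Evaluating `σ(X, ·) = -dH` on the vector in the kernel of `(T(Tp), dJ)` gives `dJ(X) = 0`, and on
the other vectors of the kernel of `dJ` it shows that the projection of `X` is the Hamiltonian field of
`H'`. Smoothness of Hamiltonian fields is a general fact about smooth nondegenerate forms
(`exists_unique_hamiltonianField`).
-/

open Filter Topology

/-! ### Pullback and exterior derivative of forms -/

section FormCalculus

variable {E : Type*} [NormedAddCommGroup E] [NormedSpace ℝ E]
  {H : Type*} [TopologicalSpace H] {I : ModelWithCorners ℝ E H}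
  {N : Type*} [TopologicalSpace N] [ChartedSpace H N]
  {E' : Type*} [NormedAddCommGroup E'] [NormedSpace ℝ E']
  {H' : Type*} [TopologicalSpace H'] {I' : ModelWithCorners ℝ E' H'}
  {N' : Type*} [TopologicalSpace N'] [ChartedSpace H' N']
  {E'' : Type*} [NormedAddCommGroup E''] [NormedSpace ℝ E'']
  {H'' : Type*} [TopologicalSpace H''] {I'' : ModelWithCorners ℝ E'' H''}
  {N'' : Type*} [TopologicalSpace N''] [ChartedSpace H'' N'']
  {n : ℕ}

namespace DiffForm

theorem pullback_apply (f : N → N') (α : DiffForm I' N' n) (x : N)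
    (v : Fin n → TangentSpace I x) :
    pullback I I' f α x v = α (f x) (fun i => mfderiv I I' f x (v i)) := rfl

/-- The value of a form on vectors of the model space depends only on the base point. -/
theorem apply_congr_point (α : DiffForm I N n) {a b : N} (h : a = b) (v : Fin n → E) :
    α a (v : Fin n → TangentSpace I a) = α b (v : Fin n → TangentSpace I b) := by
  subst h; rfl

theorem pullback_congr {f g : N → N'} (α : DiffForm I' N' n) {x : N} (h : f =ᶠ[𝓝 x] g) :
    pullback I I' f α x = pullback I I' g α x := by
  ext v
  rw [pullback_apply, pullback_apply]
  have := h.mfderiv_eq (I := I) (I' := I')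
  refine (apply_congr_point α h.self_of_nhds (fun i => mfderiv I I' f x (v i))).trans ?_
  congr 1
  funext i
  exact congrArg (fun L : E →L[ℝ] E' => L (v i)) this

theorem pullback_comp {f : N → N'} {g : N' → N''} (α : DiffForm I'' N'' n) {x : N}
    (hg : MDifferentiableAt I' I'' g (f x)) (hf : MDifferentiableAt I I' f x) :
    pullback I I'' (g ∘ f) α x = pullback I I' f (pullback I' I'' g α) x := by
  ext v
  rw [pullback_apply, pullback_apply, pullback_apply, mfderiv_comp x hg hf]
  rfl

theorem pullback_id (α : DiffForm I N n) : pullback I I id α = α := by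
  funext x
  ext v
  rw [pullback_apply, mfderiv_id]
  rfl

variable [I.Boundaryless]

theorem inChart_eq_pullback (α : DiffForm I N n) (x₀ : N) :
    inChart I α x₀ = pullback 𝓘(ℝ, E) I (extChartAt I x₀).symm α := by
  funext y
  unfold inChart
  rw [I.range_eq_univ, mfderivWithin_univ]
  rfl

theorem extChartAt_target_mem_nhds_of_mem {x₀ : N} {y : E} (hy : y ∈ (extChartAt I x₀).target) :
    (extChartAt I x₀).target ∈ 𝓝 y :=
  (isOpen_extChartAt_target x₀).mem_nhds hy

variable [IsManifold I ∞ N]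

theorem contMDiffAt_extChartAt_symm {x₀ : N} {y : E} (hy : y ∈ (extChartAt I x₀).target) :
    ContMDiffAt 𝓘(ℝ, E) I ∞ (extChartAt I x₀).symm y :=
  (contMDiffOn_extChartAt_symm x₀).contMDiffAt (extChartAt_target_mem_nhds_of_mem hy)

end DiffForm
end FormCalculus

section FormCalculus

variable {E : Type*} [NormedAddCommGroup E] [NormedSpace ℝ E]
  {H : Type*} [TopologicalSpace H] {I : ModelWithCorners ℝ E H}
  {N : Type*} [TopologicalSpace N] [ChartedSpace H N]
  {E' : Type*} [NormedAddCommGroup E'] [NormedSpace ℝ E']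
  {H' : Type*} [TopologicalSpace H'] {I' : ModelWithCorners ℝ E' H'}
  {N' : Type*} [TopologicalSpace N'] [ChartedSpace H' N']
  {n : ℕ} [I.Boundaryless] [IsManifold I ∞ N] [I'.Boundaryless] [IsManifold I' ∞ N']

namespace DiffForm

theorem two_le_infty : (2 : ℕ∞ω) ≤ ∞ := ENat.LEInfty.out

omit [I.Boundaryless] [I'.Boundaryless] in
theorem eventually_mdifferentiableAt {f : N → N'} {x : N} (hf : ContMDiffAt I I' ∞ f x) :
    ∀ᶠ x' in 𝓝 x, MDifferentiableAt I I' f x' := by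
  have h1 : ContMDiffAt I I' 1 f x := hf.of_le (by simp)
  exact ((contMDiffAt_iff_contMDiffAt_nhds (by simp)).1 h1).mono
    fun z hz => hz.mdifferentiableAt (by simp)

/-- In charts, the pullback of a form under `f` is its pullback under the coordinate expression of
`f`. -/
theorem inChart_pullback_eventuallyEq {f : N → N'} (α : DiffForm I' N' n) {x₀ : N} {x₁ : N'}
    {y : E} (hy : y ∈ (extChartAt I x₀).target)
    (hf : ContMDiffAt I I' ∞ f ((extChartAt I x₀).symm y))
    (hx₁ : f ((extChartAt I x₀).symm y) ∈ (extChartAt I' x₁).source) :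
    inChart I (pullback I I' f α) x₀ =ᶠ[𝓝 y] fun z =>
      (inChart I' α x₁ (extChartAt I' x₁ (f ((extChartAt I x₀).symm z)))).compContinuousLinearMap
        (fderiv ℝ (fun z => extChartAt I' x₁ (f ((extChartAt I x₀).symm z))) z) := by
  have hs := contMDiffAt_extChartAt_symm hy
  have hc := hs.continuousAt
  have hfd : ∀ᶠ z in 𝓝 y, MDifferentiableAt I I' f ((extChartAt I x₀).symm z) := by
    exact (hc.eventually (eventually_mdifferentiableAt hf))
  have hsrc : ∀ᶠ z in 𝓝 y, f ((extChartAt I x₀).symm z) ∈ (extChartAt I' x₁).source :=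
    (hf.continuousAt.comp hc).eventually ((isOpen_extChartAt_source x₁).mem_nhds hx₁)
  filter_upwards [hfd, hsrc.eventually_nhds, (isOpen_extChartAt_target x₀).mem_nhds hy]
    with z hz1 hz2 hz3
  have hsz := (contMDiffAt_extChartAt_symm (I := I) hz3).mdifferentiableAt (by simp)
  have hz2' := hz2.self_of_nhds
  have hch : MDifferentiableAt I' 𝓘(ℝ, E') (extChartAt I' x₁) (f ((extChartAt I x₀).symm z)) :=
    mdifferentiableAt_extChartAt (by simpa using hz2')
  rw [inChart_eq_pullback, inChart_eq_pullback, ← pullback_comp α hz1 hsz]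
  set F := fun z => extChartAt I' x₁ (f ((extChartAt I x₀).symm z)) with hF
  have hFd : MDifferentiableAt 𝓘(ℝ, E) 𝓘(ℝ, E') F z := hch.comp z (hz1.comp z hsz)
  have hev : f ∘ (extChartAt I x₀).symm =ᶠ[𝓝 z] (extChartAt I' x₁).symm ∘ F := by
    filter_upwards [hz2] with t ht
    exact ((extChartAt I' x₁).left_inv ht).symm
  have hsF := (contMDiffAt_extChartAt_symm (I := I')
    ((extChartAt I' x₁).map_source hz2')).mdifferentiableAt (by simp)
  refine (pullback_congr α hev).trans ((pullback_comp (f := F) α hsF hFd).trans ?_)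
  exact congrArg (fun L : E →L[ℝ] E' =>
    ((pullback 𝓘(ℝ, E') I' (extChartAt I' x₁).symm α (F z) :
      E' [⋀^Fin n]→L[ℝ] ℝ)).compContinuousLinearMap L) mfderiv_eq_fderiv

/-- Naturality of the exterior derivative in arbitrary charts of the source and the target; with
`f = id` this is independence of the chart. -/
theorem extDeriv_inChart_pullback {f : N → N'} {α : DiffForm I' N' n} {x₀ : N} {x₁ : N'}
    {y : E} (hy : y ∈ (extChartAt I x₀).target)
    (hf : ContMDiffAt I I' ∞ f ((extChartAt I x₀).symm y))
    (hx₁ : f ((extChartAt I x₀).symm y) ∈ (extChartAt I' x₁).source)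
    (hα : DifferentiableAt ℝ (inChart I' α x₁)
      (extChartAt I' x₁ (f ((extChartAt I x₀).symm y)))) :
    extDeriv (inChart I (pullback I I' f α) x₀) y =
      (extDeriv (inChart I' α x₁)
        (extChartAt I' x₁ (f ((extChartAt I x₀).symm y)))).compContinuousLinearMap
        ((mfderiv I' 𝓘(ℝ, E') (extChartAt I' x₁) (f ((extChartAt I x₀).symm y))).comp
          ((mfderiv I I' f ((extChartAt I x₀).symm y)).comp
            (mfderiv 𝓘(ℝ, E) I (extChartAt I x₀).symm y)) : E →L[ℝ] E') := by
  rw [(inChart_pullback_eventuallyEq α hy hf hx₁).extDeriv_eq]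
  have hs := contMDiffAt_extChartAt_symm (I := I) hy
  have hch : ContMDiffAt I' 𝓘(ℝ, E') ∞ (extChartAt I' x₁) (f ((extChartAt I x₀).symm y)) :=
    contMDiffAt_extChartAt' (by simpa using hx₁)
  have hF : ContMDiffAt 𝓘(ℝ, E) 𝓘(ℝ, E') ∞
      (fun z => extChartAt I' x₁ (f ((extChartAt I x₀).symm z))) y :=
    hch.comp y (hf.comp y hs)
  rw [extDeriv_pullback (f := fun z => extChartAt I' x₁ (f ((extChartAt I x₀).symm z))) hα
    hF.contDiffAt (minSmoothness_of_isRCLikeNormedField.le.trans two_le_infty)]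
  congr 1
  rw [← mfderiv_eq_fderiv]
  have h1 := mfderiv_comp y (hch.mdifferentiableAt (by simp))
    ((hf.comp y hs).mdifferentiableAt (by simp))
  have h2 := mfderiv_comp y (hf.mdifferentiableAt (by simp)) (hs.mdifferentiableAt (by simp))
  exact h1.trans (congrArg _ h2)

omit [IsManifold I ∞ N] in
/-- `d` on a manifold without boundary, with all derivatives within `range I = univ` replaced by
plain ones. -/
theorem d_eq (α : DiffForm I N n) (x : N) :
    d I α x = (extDeriv (inChart I α x) (extChartAt I x x)).compContinuousLinearMap
      (mfderiv I 𝓘(ℝ, E) (extChartAt I x) x : TangentSpace I x →L[ℝ] E) := by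
  unfold d
  rw [I.range_eq_univ, extDerivWithin_univ]

/-- The exterior derivative is natural under smooth maps. -/
theorem d_pullback {f : N → N'} {α : DiffForm I' N' n} {x : N} (hf : ContMDiffAt I I' ∞ f x)
    (hα : DifferentiableAt ℝ (inChart I' α (f x)) (extChartAt I' (f x) (f x))) :
    d I (pullback I I' f α) x = pullback I I' f (d I' α) x := by
  have hx : (extChartAt I x).symm (extChartAt I x x) = x := extChartAt_to_inv x
  have hxs : f x ∈ (extChartAt I' (f x)).source := mem_extChartAt_source _
  have h1 := extDeriv_inChart_pullback (f := f) (α := α) (x₀ := x) (x₁ := f x)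
    (mem_extChartAt_target x) (by rwa [hx]) (by rwa [hx]) (by rwa [hx])
  have h2 : (mfderiv 𝓘(ℝ, E) I (extChartAt I x).symm (extChartAt I x x)).comp
      (mfderiv I 𝓘(ℝ, E) (extChartAt I x) x) = ContinuousLinearMap.id ℝ (TangentSpace I x) := by
    have := mfderivWithin_extChartAt_symm_comp_mfderiv_extChartAt' (I := I)
      (mem_extChartAt_source (I := I) x)
    rwa [I.range_eq_univ, mfderivWithin_univ] at this
  have h3 : ∀ u : TangentSpace I x, (mfderiv 𝓘(ℝ, E) I (extChartAt I x).symm (extChartAt I x x))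
      (mfderiv I 𝓘(ℝ, E) (extChartAt I x) x u) = u := fun u => congrArg (fun L => L u) h2
  have key : ∀ v : Fin n.succ → E, extDeriv (inChart I (pullback I I' f α) x) (extChartAt I x x)
      (fun i => mfderiv I 𝓘(ℝ, E) (extChartAt I x) x (v i)) =
      extDeriv (inChart I' α (f x)) (extChartAt I' (f x) (f x))
        (fun i => mfderiv I' 𝓘(ℝ, E') (extChartAt I' (f x)) (f x) (mfderiv I I' f x (v i))) := by
    intro v
    refine (congrArg (fun A : E [⋀^Fin (n + 1)]→L[ℝ] ℝ =>
      A (fun i => mfderiv I 𝓘(ℝ, E) (extChartAt I x) x (v i))) h1).trans ?_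
    -- Both sides are stated at `(extChartAt I x).symm (extChartAt I x x)`, which equals `x` only
    -- propositionally: generalize the point before substituting.
    have h4 : ∀ z : N, z = x → ∀ u : Fin n.succ → E, (∀ i, u i = v i) →
        extDeriv (inChart I' α (f x)) (extChartAt I' (f x) (f z))
          (fun i => mfderiv I' 𝓘(ℝ, E') (extChartAt I' (f x)) (f z) (mfderiv I I' f z (u i))) =
        extDeriv (inChart I' α (f x)) (extChartAt I' (f x) (f x))
          (fun i => mfderiv I' 𝓘(ℝ, E') (extChartAt I' (f x)) (f x) (mfderiv I I' f x (v i))) := by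
      rintro z rfl u hu
      rw [funext hu]
    exact h4 _ hx _ (fun i => h3 (v i))
  ext v
  exact (congrArg (fun A : E [⋀^Fin (n + 1)]→L[ℝ] ℝ => A v) (d_eq (pullback I I' f α) x)).trans
    ((key v).trans (congrArg (fun A : E' [⋀^Fin (n + 1)]→L[ℝ] ℝ =>
      A (fun i => mfderiv I I' f x (v i))) (d_eq α (f x))).symm)

/-- The exterior derivative may be computed in any chart of the atlas. -/
theorem inChart_d {α : DiffForm I N n} {x₀ : N} {y : E} (hy : y ∈ (extChartAt I x₀).target)
    (hα : DifferentiableAt ℝ (inChart I α ((extChartAt I x₀).symm y))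
      (extChartAt I ((extChartAt I x₀).symm y) ((extChartAt I x₀).symm y))) :
    inChart I (d I α) x₀ y = extDeriv (inChart I α x₀) y := by
  have h1 := extDeriv_inChart_pullback (f := id) (α := α) (x₀ := x₀)
    (x₁ := (extChartAt I x₀).symm y) hy contMDiffAt_id (mem_extChartAt_source _) hα
  rw [pullback_id, mfderiv_id] at h1
  rw [h1, inChart_eq_pullback]
  ext v
  exact congrArg (fun A : E [⋀^Fin (n + 1)]→L[ℝ] ℝ =>
    A (fun i => mfderiv 𝓘(ℝ, E) I (extChartAt I x₀).symm y (v i))) (d_eq α _)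

end DiffForm
end FormCalculus

/-! ### Smooth `1`-forms -/

section SmoothForms

variable {E : Type*} [NormedAddCommGroup E] [NormedSpace ℝ E]
  {H : Type*} [TopologicalSpace H] {I : ModelWithCorners ℝ E H}
  {N : Type*} [TopologicalSpace N] [ChartedSpace H N] [IsManifold I ∞ N]
  {E' : Type*} [NormedAddCommGroup E'] [NormedSpace ℝ E']
  {H' : Type*} [TopologicalSpace H'] {I' : ModelWithCorners ℝ E' H'}
  {N' : Type*} [TopologicalSpace N'] [ChartedSpace H' N'] [IsManifold I' ∞ N']
  {n : ℕ}

/-- The tangent map of a map that is smooth at `w.proj` is smooth at `w`. -/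
theorem ContMDiffAt.tangentMap_infty {f : N → N'} {w : TangentBundle I N}
    (hf : ContMDiffAt I I' ∞ f w.proj) :
    ContMDiffAt I.tangent I'.tangent ∞ (tangentMap I I' f) w := by
  have hv : ContMDiffAt I.tangent I.tangent ∞
      (fun y : TangentBundle I N => (⟨y.proj, y.2⟩ : TangentBundle I N)) w := contMDiffAt_id
  have hb : ContMDiffAt I.tangent I ∞ (fun y : TangentBundle I N => y.proj) w :=
    Bundle.contMDiffAt_proj (TangentSpace I)
  have hb₂ : ContMDiffAt I.tangent I' ∞ (fun y : TangentBundle I N => f y.proj) w := hf.comp w hb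
  have hA := (ContMDiffAt.mfderiv_const (m := ∞) (n := ∞) hf le_rfl).comp w hb
  exact ContMDiffAt.clm_apply_of_inCoordinates hA hv hb₂

omit [IsManifold I ∞ N] in
theorem contMDiffAt_clm_of_apply {D D' : Type*} [NormedAddCommGroup D] [NormedSpace ℝ D]
    [FiniteDimensional ℝ D] [NormedAddCommGroup D'] [NormedSpace ℝ D'] {f : N → D →L[ℝ] D'} {x : N}
    {r : ℕ∞ω} (h : ∀ y, ContMDiffAt I 𝓘(ℝ, D') r (fun z => f z y) x) :
    ContMDiffAt I 𝓘(ℝ, D →L[ℝ] D') r f x := by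
  let e₁ : D ≃L[ℝ] (Fin (Module.finrank ℝ D) → ℝ) :=
    ContinuousLinearEquiv.ofFinrankEq (Module.finrank_fin_fun ℝ).symm
  let e₂ := (e₁.arrowCongr (1 : D' ≃L[ℝ] D')).trans
    (ContinuousLinearEquiv.piRing (Fin (Module.finrank ℝ D)))
  rw [← Function.id_comp f, ← e₂.symm_comp_self]
  exact e₂.symm.contDiff.contDiffAt.contMDiffAt.comp x (contMDiffAt_pi_space.mpr fun i => h _)

theorem contDiffAt_clm_of_apply {D : Type*} [NormedAddCommGroup D] [NormedSpace ℝ D]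
    [FiniteDimensional ℝ E] {f : D → E →L[ℝ] E'} {x : D} {r : ℕ∞ω}
    (h : ∀ y, ContDiffAt ℝ r (fun z => f z y) x) : ContDiffAt ℝ r f x :=
  (contMDiffAt_clm_of_apply fun y => (h y).contMDiffAt).contDiffAt

namespace DiffForm

/-- A `1`-form is smooth at `x` if, seen as a fiberwise linear function on the tangent bundle, it
is smooth at all tangent vectors at `x`. -/
def IsSmoothOneFormAt (I : ModelWithCorners ℝ E H) [IsManifold I ∞ N] (α : DiffForm I N 1)
    (x : N) : Prop :=
  ∀ u : TangentSpace I x, ContMDiffAt I.tangent 𝓘(ℝ, ℝ) ∞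
    (fun w : TangentBundle I N => α w.proj (fun _ => w.2)) ⟨x, u⟩

theorem IsSmoothOneFormAt.pullback {f : N → N'} {α : DiffForm I' N' 1} {x : N}
    (hα : IsSmoothOneFormAt I' α (f x)) (hf : ContMDiffAt I I' ∞ f x) :
    IsSmoothOneFormAt I (DiffForm.pullback I I' f α) x := fun u =>
  ContMDiffAt.comp (⟨x, u⟩ : TangentBundle I N) (g := fun w : TangentBundle I' N' =>
    α w.proj (fun _ => w.2)) (hα (mfderiv I I' f x u)) (ContMDiffAt.tangentMap_infty hf)

theorem IsSmoothOneFormAt.add {α β : DiffForm I N 1} {x : N} (hα : IsSmoothOneFormAt I α x)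
    (hβ : IsSmoothOneFormAt I β x) : IsSmoothOneFormAt I (α + β) x :=
  fun u => (hα u).add (hβ u)

theorem IsSmoothOneFormAt.smul {α : DiffForm I N 1} {f : N → ℝ} {x : N}
    (hα : IsSmoothOneFormAt I α x) (hf : ContMDiffAt I 𝓘(ℝ, ℝ) ∞ f x) :
    IsSmoothOneFormAt I (fun z => f z • α z) x :=
  fun u => (hf.comp (⟨x, u⟩ : TangentBundle I N) (Bundle.contMDiffAt_proj (TangentSpace I))).smul
    (hα u)

variable [I.Boundaryless] [FiniteDimensional ℝ E]

theorem IsSmoothOneFormAt.contDiffAt_inChart {α : DiffForm I N 1} {x₀ : N} {y : E}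
    (hy : y ∈ (extChartAt I x₀).target)
    (hα : IsSmoothOneFormAt I α ((extChartAt I x₀).symm y)) :
    ContDiffAt ℝ ∞ (inChart I α x₀) y := by
  have h1 : IsSmoothOneFormAt 𝓘(ℝ, E) (inChart I α x₀) y := by
    rw [inChart_eq_pullback]
    exact hα.pullback (contMDiffAt_extChartAt_symm hy)
  let L := ContinuousAlternatingMap.ofSubsingletonLIE (𝕜 := ℝ) (E := E) (F := ℝ) (0 : Fin 1)
  have h2 : ContDiffAt ℝ ∞ (fun z => L.symm (inChart I α x₀ z)) y := by
    refine contDiffAt_clm_of_apply fun e => ?_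
    have he : ContMDiffAt 𝓘(ℝ, E) 𝓘(ℝ, E).tangent ∞
        (fun z : E => (⟨z, e⟩ : TangentBundle 𝓘(ℝ, E) E)) y :=
      contMDiffAt_vectorSpace_iff_contDiffAt.2 contDiffAt_const
    exact (ContMDiffAt.comp y (h1 e) he).contDiffAt
  have h3 : inChart I α x₀ = fun z => L (L.symm (inChart I α x₀ z)) := by
    funext z; exact (L.apply_symm_apply _).symm
  rw [h3]
  exact L.contDiff.contDiffAt.comp y h2

theorem IsSmoothOneFormAt.differentiableAt_inChart {α : DiffForm I N 1} {x : N}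
    (hα : IsSmoothOneFormAt I α x) :
    DifferentiableAt ℝ (inChart I α x) (extChartAt I x x) :=
  (IsSmoothOneFormAt.contDiffAt_inChart (mem_extChartAt_target x)
    (by rwa [extChartAt_to_inv])).differentiableAt (by simp)

omit [FiniteDimensional ℝ E] in
theorem contDiffAt_extDeriv {η : E → E [⋀^Fin n]→L[ℝ] ℝ} {y : E} (h : ContDiffAt ℝ ∞ η y) :
    ContDiffAt ℝ ∞ (extDeriv η) y :=
  ContDiffAt.comp (g := ContinuousAlternatingMap.alternatizeUncurryFinCLM ℝ E ℝ (n := n)) y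
    (ContinuousLinearMap.contDiff _).contDiffAt (h.fderiv_right (m := ∞) le_rfl)

/-- A form that is locally the exterior derivative of smooth `1`-forms is smooth and closed. -/
theorem isSmooth_and_closed_of_locally_exact {η : DiffForm I N 2}
    (h : ∀ x, ∃ β : DiffForm I N 1, ∀ᶠ z in 𝓝 x, IsSmoothOneFormAt I β z ∧ η z = d I β z) :
    IsSmooth I η ∧ d I η = 0 := by
  have key : ∀ (x₀ : N) (y : E), y ∈ (extChartAt I x₀).target → ∃ β : DiffForm I N 1,
      ContDiffAt ℝ ∞ (inChart I β x₀) y ∧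
        inChart I η x₀ =ᶠ[𝓝 y] extDeriv (inChart I β x₀) := by
    intro x₀ y hy
    obtain ⟨β, hβ⟩ := h ((extChartAt I x₀).symm y)
    refine ⟨β, IsSmoothOneFormAt.contDiffAt_inChart hy hβ.self_of_nhds.1, ?_⟩
    filter_upwards [(contMDiffAt_extChartAt_symm hy).continuousAt.eventually hβ,
      extChartAt_target_mem_nhds_of_mem hy] with z hz hzt
    rw [← inChart_d hzt hz.1.differentiableAt_inChart]
    unfold inChart
    rw [hz.2]
  constructor
  · intro x₀ y hy
    obtain ⟨β, h1, h2⟩ := key x₀ y hy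
    exact ((contDiffAt_extDeriv h1).congr_of_eventuallyEq h2).contDiffWithinAt
  · funext x
    obtain ⟨β, h1, h2⟩ := key x _ (mem_extChartAt_target x)
    rw [d_eq, h2.extDeriv_eq, extDeriv_extDeriv_apply h1
      (minSmoothness_of_isRCLikeNormedField.le.trans two_le_infty)]
    rfl

end DiffForm
end SmoothForms

/-! ### Hamiltonian fields -/

section SmoothForms

variable {E : Type*} [NormedAddCommGroup E] [NormedSpace ℝ E]
  {H : Type*} [TopologicalSpace H] {I : ModelWithCorners ℝ E H}
  {N : Type*} [TopologicalSpace N] [ChartedSpace H N] [IsManifold I ∞ N]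
  {n : ℕ} [I.Boundaryless]

omit [IsManifold I ∞ N] [I.Boundaryless] in
/-- Tangent spaces at different points are both the model space, so that a vector may be moved
along an equality of base points. -/
theorem TangentBundle.mk_congr {a b : N} (h : a = b) (u : E) :
    (⟨a, (u : TangentSpace I a)⟩ : TangentBundle I N) = ⟨b, (u : TangentSpace I b)⟩ := by
  subst h; rfl

theorem alternatizeUncurryFin_one_apply (L : E →L[ℝ] E [⋀^Fin 1]→L[ℝ] ℝ) (a b : E) :
    ContinuousAlternatingMap.alternatizeUncurryFin L ![a, b] =
      L a (fun _ => b) - L b (fun _ => a) := by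
  have h0 : (Fin.removeNth 0 ![a, b] : Fin 1 → E) = fun _ => b := by
    funext i; fin_cases i; rfl
  have h1 : (Fin.removeNth 1 ![a, b] : Fin 1 → E) = fun _ => a := by
    funext i; fin_cases i; rfl
  rw [ContinuousAlternatingMap.alternatizeUncurryFin_apply, Fin.sum_univ_two, h0, h1]
  simp [sub_eq_add_neg]

/-- The bilinear form underlying an alternating `2`-form, depending linearly on the form. -/
noncomputable def alternatingToBilin :
    (E [⋀^Fin 2]→L[ℝ] ℝ) →L[ℝ] E →L[ℝ] E →L[ℝ] ℝ :=
  (ContinuousLinearMap.compL ℝ E (E [⋀^Fin 1]→L[ℝ] ℝ) (E →L[ℝ] ℝ)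
    (ContinuousAlternatingMap.ofSubsingletonLIE (𝕜 := ℝ) (E := E) (F := ℝ)
      (0 : Fin 1)).symm.toContinuousLinearEquiv.toContinuousLinearMap).comp
    (ContinuousAlternatingMap.curryLeftLI (𝕜 := ℝ) (E := E) (F := ℝ)
      (n := 1)).toContinuousLinearMap

theorem alternatingToBilin_apply (η : E [⋀^Fin 2]→L[ℝ] ℝ) (u v : E) :
    alternatingToBilin η u v = η ![u, v] := by
  have : (![u, v] : Fin 2 → E) = Matrix.vecCons u (fun _ : Fin 1 => v) := by
    funext i; fin_cases i <;> rfl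
  rw [this]
  rfl

/-- A nondegenerate alternating `2`-form on a finite-dimensional space is an isomorphism onto the
dual space. -/
theorem alternatingToBilin_isInvertible [FiniteDimensional ℝ E] {η : E [⋀^Fin 2]→L[ℝ] ℝ}
    (h : ∀ u, (∀ v, η ![u, v] = 0) → u = 0) : (alternatingToBilin η).IsInvertible := by
  have hinj : Function.Injective (alternatingToBilin η) := by
    refine (injective_iff_map_eq_zero _).2 fun u hu => h u fun v => ?_
    rw [← alternatingToBilin_apply, hu]
    rfl
  have hfr : Module.finrank ℝ E = Module.finrank ℝ (E →L[ℝ] ℝ) := by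
    rw [← LinearEquiv.finrank_eq (LinearMap.toContinuousLinearMap (𝕜 := ℝ) (E := E) (F' := ℝ)),
      Subspace.dual_finrank_eq]
  let e := LinearEquiv.ofInjectiveOfFinrankEq ((alternatingToBilin η) : E →ₗ[ℝ] E →L[ℝ] ℝ) hinj hfr
  exact ⟨e.toContinuousLinearEquiv, by ext; rfl⟩

/-- The vector dual to a covector with respect to a nondegenerate `2`-form. -/
noncomputable def sharp (η : E [⋀^Fin 2]→L[ℝ] ℝ) (ξ : E →L[ℝ] ℝ) : E :=
  (alternatingToBilin η).inverse ξ

theorem apply_sharp [FiniteDimensional ℝ E] {η : E [⋀^Fin 2]→L[ℝ] ℝ}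
    (h : ∀ u, (∀ v, η ![u, v] = 0) → u = 0) (ξ : E →L[ℝ] ℝ) (v : E) : η ![sharp η ξ, v] = ξ v := by
  obtain ⟨e, he⟩ := alternatingToBilin_isInvertible h
  rw [← alternatingToBilin_apply, sharp, ← he, ContinuousLinearMap.inverse_equiv]
  exact congrArg (fun L => L v) (e.apply_symm_apply ξ)

theorem eq_of_forall_apply_eq {η : E [⋀^Fin 2]→L[ℝ] ℝ}
    (h : ∀ u, (∀ v, η ![u, v] = 0) → u = 0) {u u' : E} (huu : ∀ v, η ![u, v] = η ![u', v]) :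
    u = u' := by
  refine sub_eq_zero.1 (h _ fun v => ?_)
  have := huu v
  rw [← alternatingToBilin_apply] at this ⊢
  rw [← alternatingToBilin_apply] at this
  rw [map_sub, sub_apply, this, sub_self]

/-- `sharp` is smooth, inversion of operators being smooth. -/
theorem contDiffAt_sharp [FiniteDimensional ℝ E] {D : Type*} [NormedAddCommGroup D]
    [NormedSpace ℝ D] {η : D → E [⋀^Fin 2]→L[ℝ] ℝ} {ξ : D → E →L[ℝ] ℝ} {y : D}
    (h : ∀ u, (∀ v, η y ![u, v] = 0) → u = 0) (hη : ContDiffAt ℝ ∞ η y) (hξ : ContDiffAt ℝ ∞ ξ y) :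
    ContDiffAt ℝ ∞ (fun z => sharp (η z) (ξ z)) y := by
  obtain ⟨e, he⟩ := alternatingToBilin_isInvertible h
  have hc : CompleteSpace E := FiniteDimensional.complete ℝ E
  have h1 : ContDiffAt ℝ ∞ ContinuousLinearMap.inverse (alternatingToBilin (η y)) := by
    rw [← he]; exact contDiffAt_map_inverse e
  have h2 : ContDiffAt ℝ ∞ (fun z => alternatingToBilin (η z)) y :=
    (ContinuousLinearMap.contDiff _).contDiffAt.comp y hη
  exact (h1.comp y h2).clm_apply hξ

namespace DiffForm

omit [IsManifold I ∞ N] in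
theorem d_congr {α β : DiffForm I N n} {x : N} (h : ∀ᶠ z in 𝓝 x, α z = β z) :
    d I α x = d I β x := by
  have h1 : inChart I α x =ᶠ[𝓝 (extChartAt I x x)] inChart I β x := by
    have hc : ContinuousAt (extChartAt I x).symm (extChartAt I x x) :=
      continuousAt_extChartAt_symm x
    have h' : ∀ᶠ z in 𝓝 ((extChartAt I x).symm (extChartAt I x x)), α z = β z := by
      rwa [extChartAt_to_inv]
    filter_upwards [hc.eventually h'] with y hy
    unfold inChart
    rw [hy]
  rw [d_eq, d_eq, h1.extDeriv_eq]

omit [IsManifold I ∞ N] in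
theorem d_add {α β : DiffForm I N n} {x : N}
    (hα : DifferentiableAt ℝ (inChart I α x) (extChartAt I x x))
    (hβ : DifferentiableAt ℝ (inChart I β x) (extChartAt I x x)) :
    d I (α + β) x = d I α x + d I β x := by
  have h1 : inChart I (α + β) x = inChart I α x + inChart I β x := rfl
  rw [d_eq, d_eq, d_eq, h1, extDeriv_add hα hβ]
  rfl

theorem pullback_extChartAt_inChart (α : DiffForm I N n) {x₀ x : N}
    (hx : x ∈ (extChartAt I x₀).source) :
    pullback I 𝓘(ℝ, E) (extChartAt I x₀) (inChart I α x₀) x = α x := by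
  have hφ : MDifferentiableAt I 𝓘(ℝ, E) (extChartAt I x₀) x :=
    mdifferentiableAt_extChartAt (by simpa using hx)
  have hs := (contMDiffAt_extChartAt_symm (I := I)
    ((extChartAt I x₀).map_source hx)).mdifferentiableAt (by simp)
  rw [inChart_eq_pullback, ← pullback_comp α hs hφ]
  have hev : (extChartAt I x₀).symm ∘ extChartAt I x₀ =ᶠ[𝓝 x] id := by
    filter_upwards [(isOpen_extChartAt_source x₀).mem_nhds hx] with z hz
    exact (extChartAt I x₀).left_inv hz
  rw [pullback_congr α hev, pullback_id]

theorem diffAt_eq_fderiv_chart {f : N → ℝ} {x₀ x : N} (hx : x ∈ (extChartAt I x₀).source)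
    (hf : MDifferentiableAt I 𝓘(ℝ, ℝ) f x) (u : TangentSpace I x) :
    diffAt I f x u = fderiv ℝ (fun y => f ((extChartAt I x₀).symm y)) (extChartAt I x₀ x)
      (mfderiv I 𝓘(ℝ, E) (extChartAt I x₀) x u) := by
  have hφ : MDifferentiableAt I 𝓘(ℝ, E) (extChartAt I x₀) x :=
    mdifferentiableAt_extChartAt (by simpa using hx)
  have hs := (contMDiffAt_extChartAt_symm (I := I)
    ((extChartAt I x₀).map_source hx)).mdifferentiableAt (by simp)
  have hf' : MDifferentiableAt I 𝓘(ℝ, ℝ) f ((extChartAt I x₀).symm (extChartAt I x₀ x)) := by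
    rwa [(extChartAt I x₀).left_inv hx]
  have hev : f =ᶠ[𝓝 x] (fun y => f ((extChartAt I x₀).symm y)) ∘ extChartAt I x₀ := by
    filter_upwards [(isOpen_extChartAt_source x₀).mem_nhds hx] with z hz
    exact congrArg f ((extChartAt I x₀).left_inv hz).symm
  have h1 := hev.mfderiv_eq (I := I) (I' := 𝓘(ℝ, ℝ))
  have h2 := mfderiv_comp x (MDifferentiableAt.comp (extChartAt I x₀ x) hf' hs) hφ
  refine (congrArg (fun L : E →L[ℝ] ℝ => L u) (h1.trans h2)).trans ?_
  exact congrArg (fun L : E →L[ℝ] ℝ => L (mfderiv I 𝓘(ℝ, E) (extChartAt I x₀) x u))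
    mfderiv_eq_fderiv

/-- The exterior derivative `d(fα) = df ∧ α` at a zero of `f`. -/
theorem d_smul_apply_of_eq_zero {f : N → ℝ} {α : DiffForm I N 1} {x : N}
    (hf : ContMDiffAt I 𝓘(ℝ, ℝ) ∞ f x) (hfx : f x = 0)
    (hα : DifferentiableAt ℝ (inChart I α x) (extChartAt I x x)) (u v : TangentSpace I x) :
    d I (fun z => f z • α z) x ![u, v] =
      diffAt I f x u * α x (fun _ => v) - diffAt I f x v * α x (fun _ => u) := by
  set φ := extChartAt I x x
  set F : E → ℝ := fun y => f ((extChartAt I x).symm y)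
  have hF0 : F φ = 0 := by simp only [F, φ]; rw [extChartAt_to_inv, hfx]
  have hs : ContMDiffAt 𝓘(ℝ, E) I ∞ (extChartAt I x).symm φ :=
    contMDiffAt_extChartAt_symm (mem_extChartAt_target x)
  have hf' : ContMDiffAt I 𝓘(ℝ, ℝ) ∞ f ((extChartAt I x).symm φ) := by
    simp only [φ]; rwa [extChartAt_to_inv]
  have hF : DifferentiableAt ℝ F φ := (hf'.comp φ hs).contDiffAt.differentiableAt (by simp)
  have hch : inChart I (fun z => f z • α z) x = fun y => F y • inChart I α x y := rfl
  have hd : DifferentiableAt ℝ (fun y => F y • inChart I α x y) φ := hF.smul hα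
  have h1 : fderiv ℝ (fun y => F y • inChart I α x y) φ =
      (fderiv ℝ F φ).smulRight (inChart I α x φ) := by
    rw [fderiv_fun_smul hF hα, hF0, zero_smul, zero_add]
  have hα' : ∀ w : TangentSpace I x, inChart I α x φ
      (fun _ => mfderiv I 𝓘(ℝ, E) (extChartAt I x) x w) = α x (fun _ => w) := fun w =>
    congrArg (fun A : E [⋀^Fin 1]→L[ℝ] ℝ => A (fun _ => w))
      (pullback_extChartAt_inChart α (mem_extChartAt_source x))
  have hdf := fun w : TangentSpace I x => diffAt_eq_fderiv_chart (mem_extChartAt_source x)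
    (hf.mdifferentiableAt (by simp)) w
  have h2 : ∀ a b : E, extDeriv (fun y => F y • inChart I α x y) φ ![a, b] =
      fderiv ℝ F φ a * inChart I α x φ (fun _ => b) -
      fderiv ℝ F φ b * inChart I α x φ (fun _ => a) := by
    intro a b
    rw [extDeriv, h1, alternatizeUncurryFin_one_apply]
    rfl
  rw [d_eq, hch]
  rw [hdf, hdf, ← hα', ← hα']
  refine Eq.trans ?_ (h2 _ _)
  refine congrArg (extDeriv (fun y => F y • inChart I α x y) φ) ?_
  funext i
  fin_cases i <;> rfl

theorem inChart_apply_mfderiv (α : DiffForm I N n) {x₀ x : N} (hx : x ∈ (extChartAt I x₀).source)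
    (v : Fin n → TangentSpace I x) :
    inChart I α x₀ (extChartAt I x₀ x) (fun i => mfderiv I 𝓘(ℝ, E) (extChartAt I x₀) x (v i)) =
      α x v :=
  congrArg (fun A : E [⋀^Fin n]→L[ℝ] ℝ => A v) (pullback_extChartAt_inChart α hx)

end DiffForm

open DiffForm in
/-- With respect to a smooth nondegenerate `2`-form, every smooth function has a unique Hamiltonian
field, and this field is smooth. -/
theorem exists_unique_hamiltonianField [FiniteDimensional ℝ E] {α : DiffForm I N 2}
    (hα : IsSmooth I α)
    (hnd : ∀ (x : N) (u : TangentSpace I x), (∀ u' : TangentSpace I x, α x ![u, u'] = 0) → u = 0)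
    {h : N → ℝ} (hh : ContMDiff I 𝓘(ℝ, ℝ) ∞ h) :
    ∃ X : (x : N) → TangentSpace I x, (∀ Y, IsHamiltonianField I α h Y ↔ Y = X) ∧
      IsSmoothField I X := by
  have happ : ∀ (x : N) (u : TangentSpace I x),
      α x ![sharp (E := E) (α x) (-diffAt I h x), u] = -diffAt I h x u := fun x u =>
    apply_sharp (E := E) (hnd x) (-diffAt I h x) u
  have huniq : ∀ (x : N) (a b : TangentSpace I x),
      (∀ u : TangentSpace I x, α x ![a, u] = α x ![b, u]) → a = b := fun x a b hab =>
    eq_of_forall_apply_eq (E := E) (hnd x) hab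
  refine ⟨fun x => sharp (E := E) (α x) (-diffAt I h x), fun Y => ⟨fun hY => ?_, ?_⟩, ?_⟩
  · funext x
    exact huniq x _ _ fun u => (hY x u).trans (happ x u).symm
  · rintro rfl
    exact happ
  · -- Smoothness: in a chart the field is `sharp` of the coordinate expressions of the form and
    -- of the differential, and it is carried back by the tangent map of the inverse chart.
    intro x₀
    set φ := extChartAt I x₀
    let Xh : E → E := fun y => sharp (inChart I α x₀ y) (-fderiv ℝ (fun y => h (φ.symm y)) y)
    have hpt : ∀ {y}, y ∈ φ.target → ∀ u : E,
        (∀ v, inChart I α x₀ y ![u, v] = 0) → u = 0 := by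
      intro y hy u hu
      obtain ⟨e, he⟩ := isInvertible_mfderivWithin_extChartAt_symm (I := I) hy
      have h1 : e u = 0 := by
        refine hnd _ _ fun u' => ?_
        have h2 : inChart I α x₀ y ![u, e.symm u'] = α (φ.symm y) ![e u, e (e.symm u')] := by
          unfold inChart
          rw [← he]
          refine congrArg (α (φ.symm y)) ?_
          funext i
          fin_cases i <;> rfl
        rw [e.apply_symm_apply] at h2
        exact h2.symm.trans (hu _)
      exact e.map_eq_zero_iff.1 h1
    have hφt : φ x₀ ∈ φ.target := mem_extChartAt_target x₀
    have hsm : ContDiffAt ℝ ∞ Xh (φ x₀) := by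
      refine contDiffAt_sharp (hpt hφt)
        ((hα x₀).contDiffAt ((isOpen_extChartAt_target x₀).mem_nhds hφt)) ?_
      have h1 : ContDiffAt ℝ ∞ (fun y => h (φ.symm y)) (φ x₀) :=
        (hh.contMDiffAt.comp _ (contMDiffAt_extChartAt_symm hφt)).contDiffAt
      exact (h1.fderiv_right (m := ∞) le_rfl).neg
    have hmap : ContMDiffAt I I.tangent ∞ (fun x => tangentMap 𝓘(ℝ, E) I φ.symm
        (⟨φ x, Xh (φ x)⟩ : TangentBundle 𝓘(ℝ, E) E)) x₀ := by
      have h1 : ContMDiffAt 𝓘(ℝ, E) 𝓘(ℝ, E).tangent ∞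
          (fun y : E => (⟨y, Xh y⟩ : TangentBundle 𝓘(ℝ, E) E)) (φ x₀) :=
        contMDiffAt_vectorSpace_iff_contDiffAt.2 hsm
      have h2 : ContMDiffAt 𝓘(ℝ, E).tangent I.tangent ∞ (tangentMap 𝓘(ℝ, E) I φ.symm)
          (⟨φ x₀, Xh (φ x₀)⟩ : TangentBundle 𝓘(ℝ, E) E) :=
        ContMDiffAt.tangentMap_infty (contMDiffAt_extChartAt_symm hφt)
      exact (h2.comp (φ x₀) h1).comp x₀ contMDiffAt_extChartAt
    refine hmap.congr_of_eventuallyEq ?_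
    filter_upwards [(isOpen_extChartAt_source (I := I) x₀).mem_nhds (mem_extChartAt_source x₀)]
      with x hx
    let Z : TangentSpace I x := (mfderiv 𝓘(ℝ, E) I φ.symm (φ x) (Xh (φ x)) : E)
    have hZ : mfderiv I 𝓘(ℝ, E) φ x Z = Xh (φ x) := by
      have h1 := mfderiv_extChartAt_comp_mfderivWithin_extChartAt_symm' (I := I) hx
      rw [I.range_eq_univ, mfderivWithin_univ] at h1
      exact congrArg (fun L : E →L[ℝ] E => L (Xh (φ x))) h1
    have hEq : sharp (E := E) (α x) (-diffAt I h x) = Z := by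
      refine huniq x _ _ fun u => (happ x u).trans ?_
      rw [← inChart_apply_mfderiv α hx,
        diffAt_eq_fderiv_chart hx (hh.contMDiffAt.mdifferentiableAt (by simp))]
      have h2 : (fun i => mfderiv I 𝓘(ℝ, E) φ x ((![Z, u] : Fin 2 → TangentSpace I x) i)) =
          ![Xh (φ x), mfderiv I 𝓘(ℝ, E) φ x u] := by
        funext i
        fin_cases i
        · exact hZ
        · rfl
      refine Eq.symm ((congrArg (inChart I α x₀ (φ x)) h2).trans ?_)
      exact apply_sharp (hpt (φ.map_source hx)) _ _
    exact (congrArg (fun a : E => (⟨x, a⟩ : TangentBundle I N)) hEq).trans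
      (TangentBundle.mk_congr (φ.left_inv hx).symm _)

end SmoothForms

/-! ### Smoothness of metrics -/

section Metric

variable {E : Type*} [NormedAddCommGroup E] [NormedSpace ℝ E]
  {M : Type*} [TopologicalSpace M] [ChartedSpace E M] [IsManifold 𝓘(ℝ, E) ∞ M]
  {EZ : Type*} [NormedAddCommGroup EZ] [NormedSpace ℝ EZ]
  {HZ : Type*} [TopologicalSpace HZ] {IZ : ModelWithCorners ℝ EZ HZ}
  {Z : Type*} [TopologicalSpace Z] [ChartedSpace HZ Z]

theorem RiemMetric.contMDiffAt_inner (m : RiemMetric E M) {b : Z → M}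
    {v w : ∀ z, TangentSpace 𝓘(ℝ, E) (b z)} {z₀ : Z}
    (hv : ContMDiffAt IZ 𝓘(ℝ, E).tangent ∞ (fun z => (⟨b z, v z⟩ : TangentBundle 𝓘(ℝ, E) M)) z₀)
    (hw : ContMDiffAt IZ 𝓘(ℝ, E).tangent ∞ (fun z => (⟨b z, w z⟩ : TangentBundle 𝓘(ℝ, E) M)) z₀) :
    ContMDiffAt IZ 𝓘(ℝ, ℝ) ∞ (fun z => m.inner (b z) (v z) (w z)) z₀ := by
  have hb : ContMDiffAt IZ 𝓘(ℝ, E) ∞ b z₀ :=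
    (Bundle.contMDiff_proj (TangentSpace 𝓘(ℝ, E))).contMDiffAt.comp z₀ hv
  have : ContMDiffAt IZ (𝓘(ℝ, E).prod 𝓘(ℝ, ℝ)) ∞ (fun z =>
      Bundle.TotalSpace.mk' ℝ (E := Bundle.Trivial M ℝ) (b z) (m.inner (b z) (v z) (w z))) z₀ := by
    apply ContMDiffAt.clm_bundle_apply₂ (F₁ := E) (F₂ := E)
    · exact m.contMDiff.contMDiffAt.comp z₀ hb
    · exact hv
    · exact hw
  rw [Bundle.contMDiffAt_totalSpace] at this
  exact this.2

theorem contMDiff_proj_tangentBundle :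
    ContMDiff 𝓘(ℝ, E).tangent 𝓘(ℝ, E) ∞ (fun w : TangentBundle 𝓘(ℝ, E) M => w.proj) :=
  Bundle.contMDiff_proj (TangentSpace 𝓘(ℝ, E))

/-- A field of bilinear forms is smooth as soon as its values on smooth vector fields are. -/
theorem contMDiff_bilinear_of_apply [FiniteDimensional ℝ E]
    {G : ∀ x : M, TangentSpace 𝓘(ℝ, E) x →L[ℝ] TangentSpace 𝓘(ℝ, E) x →L[ℝ] ℝ}
    (h : ∀ (x₀ : M) (X Y : ∀ x : M, TangentSpace 𝓘(ℝ, E) x),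
      ContMDiffAt 𝓘(ℝ, E) 𝓘(ℝ, E).tangent ∞ (fun x => (⟨x, X x⟩ : TangentBundle 𝓘(ℝ, E) M)) x₀ →
      ContMDiffAt 𝓘(ℝ, E) 𝓘(ℝ, E).tangent ∞ (fun x => (⟨x, Y x⟩ : TangentBundle 𝓘(ℝ, E) M)) x₀ →
      ContMDiffAt 𝓘(ℝ, E) 𝓘(ℝ, ℝ) ∞ (fun x => G x (X x) (Y x)) x₀) :
    ContMDiff 𝓘(ℝ, E) (𝓘(ℝ, E).prod 𝓘(ℝ, E →L[ℝ] E →L[ℝ] ℝ)) ∞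
      (fun x => Bundle.TotalSpace.mk' (E →L[ℝ] E →L[ℝ] ℝ)
        (E := fun x : M => TangentSpace 𝓘(ℝ, E) x →L[ℝ] TangentSpace 𝓘(ℝ, E) x →L[ℝ] ℝ)
        x (G x)) := by
  intro x₀
  rw [contMDiffAt_hom_bundle]
  refine ⟨contMDiffAt_id, ?_⟩
  set e := trivializationAt E (TangentSpace 𝓘(ℝ, E) : M → Type _) x₀
  have hx₀ : x₀ ∈ e.baseSet := FiberBundle.mem_baseSet_trivializationAt' x₀
  have hs : ∀ c : E, ContMDiffAt 𝓘(ℝ, E) 𝓘(ℝ, E).tangent ∞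
      (fun x => (⟨x, e.symmL ℝ x c⟩ : TangentBundle 𝓘(ℝ, E) M)) x₀ := by
    intro c
    rw [Bundle.contMDiffAt_totalSpace]
    refine ⟨contMDiffAt_id, contMDiffAt_const (c := c) |>.congr_of_eventuallyEq ?_⟩
    filter_upwards [e.open_baseSet.mem_nhds hx₀] with x hx
    rw [e.symmL_apply hx]
    exact congrArg Prod.snd (e.apply_mk_symm hx c)
  refine contMDiffAt_clm_of_apply fun c => contMDiffAt_clm_of_apply fun c' => ?_
  refine (h x₀ _ _ (hs c) (hs c')).congr_of_eventuallyEq ?_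
  filter_upwards [e.open_baseSet.mem_nhds hx₀] with x hx
  refine (inCoordinates_apply_eq₂ hx hx (by simp)).trans ?_
  rw [e.symmL_apply hx, e.symmL_apply hx]
  simp [e]

end Metric

/-! ### The Lagrange forms -/

section LagrangeForm
variable {E : Type*} [NormedAddCommGroup E] [NormedSpace ℝ E]

/-- A one-form on `E × E` that is horizontal, linear along the fiber through the base point and
nondegenerate there has a nondegenerate exterior derivative. -/
theorem extDeriv_nondegenerate_of_fiberwise_linear {θ : E × E → (E × E) [⋀^Fin 1]→L[ℝ] ℝ}
    {y₀ e₀ : E} (hd : DifferentiableAt ℝ θ (y₀, e₀)) (B : E →ₗ[ℝ] E →ₗ[ℝ] ℝ)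
    (hhor : ∀ᶠ z in 𝓝 (y₀, e₀), ∀ e : E, θ z (fun _ => (0, e)) = 0)
    (hlin : ∀ e y' e' : E, θ (y₀, e) (fun _ => (y', e')) = B e y')
    (hB₁ : ∀ y', (∀ e, B e y' = 0) → y' = 0) (hB₂ : ∀ e, (∀ y', B e y' = 0) → e = 0)
    (u : E × E) (hu : ∀ v, extDeriv θ (y₀, e₀) ![u, v] = 0) : u = 0 := by
  have happ : ∀ a b : E × E, HasFDerivAt (fun z => θ z (fun _ => b))
      ((ContinuousAlternatingMap.apply ℝ (E × E) ℝ (fun _ : Fin 1 => b)).comp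
        (fderiv ℝ θ (y₀, e₀))) (y₀, e₀) := fun a b =>
    (ContinuousAlternatingMap.apply ℝ (E × E) ℝ (fun _ : Fin 1 => b)).hasFDerivAt.comp _
      hd.hasFDerivAt
  -- `θ` kills vertical vectors, hence so do its derivatives.
  have h1 : ∀ (a : E × E) (e : E), fderiv ℝ θ (y₀, e₀) a (fun _ => (0, e)) = 0 := by
    intro a e
    have h2 := (happ a (0, e)).congr_of_eventuallyEq
      (f₁ := fun _ => (0 : ℝ)) (hhor.mono fun z hz => (hz e).symm)
    have h3 := h2.unique (hasFDerivAt_const 0 _)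
    exact congrArg (fun L => L a) h3
  -- The vertical derivative of `θ` is `B`, as `θ` is linear along the fiber.
  have h2 : ∀ e y' e' : E, fderiv ℝ θ (y₀, e₀) (0, e) (fun _ => (y', e')) = B e y' := by
    intro e y' e'
    have hl : HasDerivAt (fun t : ℝ => ((y₀, e₀ + t • e) : E × E)) (0, e) 0 := by
      have : HasDerivAt (fun t : ℝ => e₀ + t • e) e 0 := by
        simpa using ((hasDerivAt_id (0 : ℝ)).smul_const e).const_add e₀
      exact (hasDerivAt_const (0 : ℝ) y₀).prodMk this
    have hf := happ (0, e) (y', e')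
    have h3 : HasDerivAt (fun t : ℝ => θ (y₀, e₀ + t • e) (fun _ => (y', e')))
        (fderiv ℝ θ (y₀, e₀) (0, e) (fun _ => (y', e'))) 0 := by
      have hf' : HasFDerivAt (fun z => θ z (fun _ => (y', e')))
        ((ContinuousAlternatingMap.apply ℝ (E × E) ℝ (fun _ : Fin 1 => (y', e'))).comp
        (fderiv ℝ θ (y₀, e₀))) (y₀, e₀ + (0 : ℝ) • e) := by simpa using hf
      exact hf'.comp_hasDerivAt 0 hl
    have h4 : HasDerivAt (fun t : ℝ => θ (y₀, e₀ + t • e) (fun _ => (y', e'))) (B e y') 0 := by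
      simp_rw [hlin]
      simp only [map_add, map_smul, LinearMap.add_apply, LinearMap.smul_apply, smul_eq_mul]
      simpa using ((hasDerivAt_id (0 : ℝ)).mul_const (B e y')).const_add (B e₀ y')
    exact h3.unique h4
  have hu' : ∀ v, fderiv ℝ θ (y₀, e₀) u (fun _ => v) = fderiv ℝ θ (y₀, e₀) v (fun _ => u) := by
    intro v
    have := hu v
    rw [extDeriv, alternatizeUncurryFin_one_apply] at this
    exact sub_eq_zero.1 this
  obtain ⟨y₁, e₁⟩ := u
  have hy₁ : y₁ = 0 := hB₁ _ fun e => by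
    rw [← h2 e y₁ e₁, ← hu', h1]
  subst hy₁
  have he₁ : e₁ = 0 := hB₂ _ fun y' => by
    rw [← h2 e₁ y' 0, hu', h1]
  rw [he₁]; rfl

end LagrangeForm

section LagrangeForm

variable {E : Type*} [NormedAddCommGroup E] [NormedSpace ℝ E]
  {M : Type*} [TopologicalSpace M] [ChartedSpace E M] [IsManifold 𝓘(ℝ, E) ∞ M]

theorem lagrangeOneForm_apply (m : RiemMetric E M) (w : TangentBundle 𝓘(ℝ, E) M)
    (Y : TangentSpace 𝓘(ℝ, E).tangent w) :
    lagrangeOneForm m w (fun _ => Y) = m.inner w.proj w.2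
      (mfderiv 𝓘(ℝ, E).tangent 𝓘(ℝ, E) (fun w' : TangentBundle 𝓘(ℝ, E) M => w'.proj) w Y) := rfl

theorem isSmoothOneFormAt_lagrangeOneForm (m : RiemMetric E M) (w : TangentBundle 𝓘(ℝ, E) M) :
    DiffForm.IsSmoothOneFormAt 𝓘(ℝ, E).tangent (lagrangeOneForm m) w := by
  intro u
  have h1 : ContMDiffAt 𝓘(ℝ, E).tangent.tangent 𝓘(ℝ, E).tangent ∞
      (fun Y : TangentBundle 𝓘(ℝ, E).tangent (TangentBundle 𝓘(ℝ, E) M) =>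
        (⟨Y.proj.proj, Y.proj.2⟩ : TangentBundle 𝓘(ℝ, E) M)) ⟨w, u⟩ :=
    Bundle.contMDiffAt_proj (TangentSpace 𝓘(ℝ, E).tangent)
  have h2 : ContMDiffAt 𝓘(ℝ, E).tangent.tangent 𝓘(ℝ, E).tangent ∞
      (tangentMap 𝓘(ℝ, E).tangent 𝓘(ℝ, E) (fun w' : TangentBundle 𝓘(ℝ, E) M => w'.proj)) ⟨w, u⟩ :=
    ContMDiffAt.tangentMap_infty contMDiff_proj_tangentBundle.contMDiffAt
  exact m.contMDiffAt_inner h1 h2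

theorem extChartAt_symm_mem_baseSet {x₀ : M} {y : E} (hy : y ∈ (extChartAt 𝓘(ℝ, E) x₀).target) :
    (extChartAt 𝓘(ℝ, E) x₀).symm y ∈
      (trivializationAt E (TangentSpace 𝓘(ℝ, E) : M → Type _) x₀).baseSet := by
  simpa using! (extChartAt 𝓘(ℝ, E) x₀).map_target hy

/-- The inverse of the chart of the tangent bundle around `w₀`, in terms of the chart of `M` and the
trivialization around the foot point of `w₀`. -/
theorem extChartAt_tangent_symm_apply (w₀ : TangentBundle 𝓘(ℝ, E) M) {y : E}
    (hy : y ∈ (extChartAt 𝓘(ℝ, E) w₀.proj).target) (c : E) :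
    (extChartAt 𝓘(ℝ, E).tangent w₀).symm (y, c) =
      ⟨(extChartAt 𝓘(ℝ, E) w₀.proj).symm y,
        (trivializationAt E (TangentSpace 𝓘(ℝ, E) : M → Type _) w₀.proj).symm
          ((extChartAt 𝓘(ℝ, E) w₀.proj).symm y) c⟩ := by
  have h := (trivializationAt E (TangentSpace 𝓘(ℝ, E) : M → Type _) w₀.proj).mk_symm
    (extChartAt_symm_mem_baseSet hy) c
  refine Eq.trans ?_ h.symm
  rw [FiberBundle.extChartAt]
  rfl

/-- The coordinate expression of the Lagrange form: it is horizontal, and linear in the fiber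
coordinate `c`. -/
theorem inChart_lagrangeOneForm (m : RiemMetric E M) (w₀ : TangentBundle 𝓘(ℝ, E) M) {y : E}
    (hy : y ∈ (extChartAt 𝓘(ℝ, E) w₀.proj).target) (c : E) (b : E × E) :
    DiffForm.inChart 𝓘(ℝ, E).tangent (lagrangeOneForm m) w₀ (y, c) (fun _ => b) =
      m.inner ((extChartAt 𝓘(ℝ, E) w₀.proj).symm y)
        ((trivializationAt E (TangentSpace 𝓘(ℝ, E) : M → Type _) w₀.proj).symm
          ((extChartAt 𝓘(ℝ, E) w₀.proj).symm y) c)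
        (mfderiv 𝓘(ℝ, E) 𝓘(ℝ, E) (extChartAt 𝓘(ℝ, E) w₀.proj).symm y b.1) := by
  set φ := extChartAt 𝓘(ℝ, E).tangent w₀
  set ψ := extChartAt 𝓘(ℝ, E) w₀.proj
  set π : TangentBundle 𝓘(ℝ, E) M → M := fun w => w.proj
  have hz : (y, c) ∈ φ.target := by
    simp only [φ]
    rw [FiberBundle.extChartAt_target]
    exact ⟨⟨hy, extChartAt_symm_mem_baseSet hy⟩, trivial⟩
  have hsy := extChartAt_tangent_symm_apply w₀ hy c
  have hφs : MDifferentiableAt 𝓘(ℝ, E × E) 𝓘(ℝ, E).tangent φ.symm (y, c) :=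
    (DiffForm.contMDiffAt_extChartAt_symm hz).mdifferentiableAt (by simp)
  have hψs : MDifferentiableAt 𝓘(ℝ, E) 𝓘(ℝ, E) ψ.symm y :=
    (DiffForm.contMDiffAt_extChartAt_symm hy).mdifferentiableAt (by simp)
  have hπ : MDifferentiableAt 𝓘(ℝ, E).tangent 𝓘(ℝ, E) π (φ.symm (y, c)) :=
    contMDiff_proj_tangentBundle.contMDiffAt.mdifferentiableAt (by simp)
  have hev : π ∘ φ.symm =ᶠ[𝓝 (y, c)] ψ.symm ∘ (Prod.fst : E × E → E) := by
    have : ∀ᶠ z : E × E in 𝓝 (y, c), z.1 ∈ ψ.target :=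
      continuous_fst.continuousAt.eventually (DiffForm.extChartAt_target_mem_nhds_of_mem hy)
    filter_upwards [this] with z hz
    exact congrArg π (extChartAt_tangent_symm_apply w₀ hz z.2)
  have hfst : MDifferentiableAt 𝓘(ℝ, E × E) 𝓘(ℝ, E) (Prod.fst : E × E → E) (y, c) :=
    mdifferentiableAt_iff_differentiableAt.2 differentiableAt_fst
  have h1 : mfderiv 𝓘(ℝ, E).tangent 𝓘(ℝ, E) π (φ.symm (y, c))
      (mfderiv 𝓘(ℝ, E × E) 𝓘(ℝ, E).tangent φ.symm (y, c) b) =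
      (mfderiv 𝓘(ℝ, E) 𝓘(ℝ, E) ψ.symm y b.1 : E) := by
    have h2 := mfderiv_comp (y, c) hπ hφs
    have h3 := hev.mfderiv_eq (I := 𝓘(ℝ, E × E)) (I' := 𝓘(ℝ, E))
    have h4 := mfderiv_comp (y, c) (g := ψ.symm) (f := Prod.fst) hψs hfst
    have h5 : mfderiv 𝓘(ℝ, E × E) 𝓘(ℝ, E) (Prod.fst : E × E → E) (y, c) =
      ContinuousLinearMap.fst ℝ E E := by rw [mfderiv_eq_fderiv]; exact fderiv_fst
    have h6 := congrArg (fun L : E × E →L[ℝ] E => L b) (h2.symm.trans (h3.trans h4))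
    refine h6.trans ?_
    exact congrArg (fun L : E × E →L[ℝ] E => mfderiv 𝓘(ℝ, E) 𝓘(ℝ, E) ψ.symm y (L b)) h5
  have h7 : ∀ (z : TangentBundle 𝓘(ℝ, E) M) (x : M) (s t t' : E), z = ⟨x, s⟩ → t = t' →
      m.inner z.proj z.2 t = m.inner x (s : TangentSpace 𝓘(ℝ, E) x) t' := by
    rintro _ x s t _ rfl rfl; rfl
  rw [DiffForm.inChart_eq_pullback]
  exact h7 _ _ _ _ _ hsy h1

theorem lagrangeTwoForm_nondegenerate [FiniteDimensional ℝ E] (m : RiemMetric E M)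
    (w : TangentBundle 𝓘(ℝ, E) M)
    (u : TangentSpace 𝓘(ℝ, E).tangent w) (hu : ∀ u', lagrangeTwoForm m w ![u, u'] = 0) : u = 0 := by
  set φ := extChartAt 𝓘(ℝ, E).tangent w
  set ψ := extChartAt 𝓘(ℝ, E) w.proj
  set e := trivializationAt E (TangentSpace 𝓘(ℝ, E) : M → Type _) w.proj
  obtain ⟨y₀, e₀, hφw⟩ : ∃ y₀ e₀, φ w = (y₀, e₀) := ⟨_, _, rfl⟩
  have hφt : φ w ∈ φ.target := mem_extChartAt_target w
  have hy₀ : y₀ ∈ ψ.target := by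
    rw [hφw] at hφt
    simp only [φ] at hφt
    rw [FiberBundle.extChartAt_target] at hφt
    exact hφt.1.1
  have hb : ψ.symm y₀ ∈ e.baseSet := extChartAt_symm_mem_baseSet hy₀
  obtain ⟨D, hD⟩ : ∃ D : E ≃L[ℝ] TangentSpace 𝓘(ℝ, E) (ψ.symm y₀),
      (D : E →L[ℝ] TangentSpace 𝓘(ℝ, E) (ψ.symm y₀)) =
        mfderiv 𝓘(ℝ, E) 𝓘(ℝ, E) ψ.symm y₀ := by
    have := isInvertible_mfderivWithin_extChartAt_symm (I := 𝓘(ℝ, E)) hy₀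
    rw [ModelWithCorners.range_eq_univ, mfderivWithin_univ] at this
    exact this
  let S : E ≃L[ℝ] TangentSpace 𝓘(ℝ, E) (ψ.symm y₀) := (e.continuousLinearEquivAt ℝ _ hb).symm
  have hS : ∀ c, S c = e.symm (ψ.symm y₀) c := fun c => rfl
  -- The metric read through the trivialization in the first argument and the chart in the second.
  let B : E →ₗ[ℝ] E →ₗ[ℝ] ℝ := LinearMap.mk₂ ℝ (fun c y => m.inner (ψ.symm y₀) (S c) (D y))
    (by intros; simp) (by intros; simp) (by intros; simp) (by intros; simp)
  have hpos : ∀ v, m.inner (ψ.symm y₀) v v = 0 → v = 0 := fun v hv => by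
    by_contra h; exact (m.pos _ v h).ne' hv
  have hd : DifferentiableAt ℝ (DiffForm.inChart 𝓘(ℝ, E).tangent (lagrangeOneForm m) w)
      (y₀, e₀) := by
    rw [← hφw]
    exact (isSmoothOneFormAt_lagrangeOneForm m w).differentiableAt_inChart
  have hnd := extDeriv_nondegenerate_of_fiberwise_linear hd B
    (by
      have : ∀ᶠ z : E × E in 𝓝 (y₀, e₀), z.1 ∈ ψ.target :=
        continuous_fst.continuousAt.eventually (DiffForm.extChartAt_target_mem_nhds_of_mem hy₀)
      filter_upwards [this] with z hz c
      refine (inChart_lagrangeOneForm m w hz z.2 (0, c)).trans ?_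
      exact (congrArg _ (map_zero (mfderiv 𝓘(ℝ, E) 𝓘(ℝ, E) ψ.symm z.1))).trans (map_zero _))
    (by
      intro c y' c'
      refine (inChart_lagrangeOneForm m w hy₀ c (y', c')).trans ?_
      exact congrArg (fun L : E →L[ℝ] E => m.inner (ψ.symm y₀) (S c) (L y')) hD.symm)
    (by
      intro y' h
      have h1 := h (S.symm (D y'))
      have h2 : m.inner (ψ.symm y₀) (S (S.symm (D y'))) (D y') = 0 := h1
      rw [S.apply_symm_apply] at h2
      exact D.map_eq_zero_iff.1 (hpos _ h2))
    (by
      intro c h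
      have h1 := h (D.symm (S c))
      have h2 : m.inner (ψ.symm y₀) (S c) (D (D.symm (S c))) = 0 := h1
      rw [D.apply_symm_apply] at h2
      exact S.map_eq_zero_iff.1 (hpos _ h2))
  obtain ⟨P, hP⟩ := isInvertible_mfderiv_extChartAt (I := 𝓘(ℝ, E).tangent)
    (mem_extChartAt_source (I := 𝓘(ℝ, E).tangent) w)
  have h0 : P u = 0 := by
    refine hnd _ fun v => ?_
    have h1 := hu (P.symm v)
    rw [lagrangeTwoForm, DiffForm.d_eq] at h1
    rw [← hφw]
    refine Eq.trans ?_ h1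
    refine congrArg (extDeriv (DiffForm.inChart 𝓘(ℝ, E).tangent (lagrangeOneForm m) w) (φ w)) ?_
    rw [← hP]
    funext i
    fin_cases i
    · rfl
    · exact (P.apply_symm_apply v).symm
  exact P.map_eq_zero_iff.1 h0

theorem lagrangeTwoForm_isSymplectic [FiniteDimensional ℝ E] (m : RiemMetric E M) :
    DiffForm.IsSymplectic 𝓘(ℝ, E).tangent (lagrangeTwoForm m) := by
  have h := DiffForm.isSmooth_and_closed_of_locally_exact (η := lagrangeTwoForm m) fun x =>
    ⟨lagrangeOneForm m, Eventually.of_forall fun z =>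
      ⟨isSmoothOneFormAt_lagrangeOneForm m z, rfl⟩⟩
  exact ⟨h.1, h.2, lagrangeTwoForm_nondegenerate m⟩

end LagrangeForm

/-! ### The flow and its generating field -/

section Flow

variable {E : Type*} [NormedAddCommGroup E] [NormedSpace ℝ E]
  {M : Type*} [TopologicalSpace M] [ChartedSpace E M] [IsManifold 𝓘(ℝ, E) ∞ M]
  {F : Type*} [NormedAddCommGroup F] [NormedSpace ℝ F]
  {B : Type*} [TopologicalSpace B] [ChartedSpace F B] [IsManifold 𝓘(ℝ, F) ∞ B]
  {g : ℝ → M → M} {p : M → B}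

namespace IsPrincipalFlowBundle

section
variable (hp : IsPrincipalFlowBundle E F g p)
include hp

omit [IsManifold 𝓘(ℝ, E) ∞ M] [IsManifold 𝓘(ℝ, F) ∞ B]

theorem contMDiff_flow (τ : ℝ) : ContMDiff 𝓘(ℝ, E) 𝓘(ℝ, E) ∞ (g τ) :=
  hp.smooth_action.comp (contMDiff_const.prodMk contMDiff_id)

theorem contMDiff_orbit (x : M) : ContMDiff 𝓘(ℝ, ℝ) 𝓘(ℝ, E) ∞ (fun τ => g τ x) :=
  hp.smooth_action.comp (contMDiff_id.prodMk contMDiff_const)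

theorem mdifferentiableAt_flow (τ : ℝ) (x : M) : MDifferentiableAt 𝓘(ℝ, E) 𝓘(ℝ, E) (g τ) x :=
  (hp.contMDiff_flow τ).contMDiffAt.mdifferentiableAt (by simp)

theorem mdifferentiableAt_orbit (x : M) (τ : ℝ) :
    MDifferentiableAt 𝓘(ℝ, ℝ) 𝓘(ℝ, E) (fun τ => g τ x) τ :=
  (hp.contMDiff_orbit x).contMDiffAt.mdifferentiableAt (by simp)

theorem mdifferentiableAt_proj (x : M) : MDifferentiableAt 𝓘(ℝ, E) 𝓘(ℝ, F) p x :=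
  hp.smooth_proj.contMDiffAt.mdifferentiableAt (by simp)

theorem proj_flow (τ : ℝ) (x : M) : p (g τ x) = p x := ((hp.fiber x (g τ x)).2 ⟨τ, rfl⟩).symm

theorem flow_neg_flow (τ : ℝ) (x : M) : g (-τ) (g τ x) = x := by
  rw [← hp.add, neg_add_cancel, hp.zero]

theorem flow_flow_neg (τ : ℝ) (x : M) : g τ (g (-τ) x) = x := by
  rw [← hp.add, add_neg_cancel, hp.zero]

/-- The generating field is invariant under the flow. -/
theorem mfderiv_flow_generator (τ : ℝ) (x : M) :
    (mfderiv 𝓘(ℝ, E) 𝓘(ℝ, E) (g τ) x (generator E g x) : E) = (generator E g (g τ x) : E) := by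
  have h1 : (fun τ' : ℝ => g τ' (g τ x)) = g τ ∘ fun τ' => g τ' x := by
    funext τ'
    simp only [Function.comp]
    rw [← hp.add, ← hp.add, add_comm]
  have h2 := mfderiv_comp (0 : ℝ) (hp.mdifferentiableAt_flow τ (g 0 x))
    (hp.mdifferentiableAt_orbit x 0)
  rw [← h1] at h2
  have h3 : (mfderiv 𝓘(ℝ, E) 𝓘(ℝ, E) (g τ) (g 0 x) : E →L[ℝ] E) =
      mfderiv 𝓘(ℝ, E) 𝓘(ℝ, E) (g τ) x := by rw [hp.zero]
  have h4 := congrArg (fun L : ℝ →L[ℝ] E => L 1) h2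
  exact (h4.trans (congrArg (fun L : E →L[ℝ] E => L (generator E g x)) h3)).symm

/-- The velocity of an orbit is the generating field. -/
theorem mfderiv_orbit (τ : ℝ) (x : M) :
    (mfderiv 𝓘(ℝ, ℝ) 𝓘(ℝ, E) (fun τ => g τ x) τ (1 : ℝ) : E) = (generator E g (g τ x) : E) := by
  have h1 : (fun τ' : ℝ => g τ' (g τ x)) = (fun τ' => g τ' x) ∘ fun τ' => τ' + τ := by
    funext τ'
    simp only [Function.comp]
    rw [← hp.add]
  have hd : MDifferentiableAt 𝓘(ℝ, ℝ) 𝓘(ℝ, ℝ) (fun τ' : ℝ => τ' + τ) 0 :=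
    mdifferentiableAt_iff_differentiableAt.2 (by fun_prop)
  have h2 := mfderiv_comp (0 : ℝ) (hp.mdifferentiableAt_orbit x (0 + τ)) hd
  rw [← h1] at h2
  have h3 : mfderiv 𝓘(ℝ, ℝ) 𝓘(ℝ, ℝ) (fun τ' : ℝ => τ' + τ) 0 = ContinuousLinearMap.id ℝ ℝ := by
    rw [mfderiv_eq_fderiv, fderiv_add_const]
    exact fderiv_id
  have h4 : (mfderiv 𝓘(ℝ, ℝ) 𝓘(ℝ, E) (fun τ => g τ x) (0 + τ) : ℝ →L[ℝ] E) =
      mfderiv 𝓘(ℝ, ℝ) 𝓘(ℝ, E) (fun τ => g τ x) τ := by rw [zero_add]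
  have h5 := congrArg (fun L : ℝ →L[ℝ] E => L 1) h2
  refine (h5.trans ?_).symm
  refine (congrArg (fun L : ℝ →L[ℝ] ℝ => mfderiv 𝓘(ℝ, ℝ) 𝓘(ℝ, E) (fun τ => g τ x) (0 + τ) (L 1))
    h3).trans ?_
  exact congrArg (fun L : ℝ →L[ℝ] E => L 1) h4

theorem mfderiv_action (τ : ℝ) (x : M) (a : ℝ) (u : E) :
    (mfderiv (𝓘(ℝ, ℝ).prod 𝓘(ℝ, E)) 𝓘(ℝ, E) (fun q : ℝ × M => g q.1 q.2) (τ, x) (a, u) :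
      TangentSpace 𝓘(ℝ, E) (g τ x)) =
      a • generator E g (g τ x) + mfderiv 𝓘(ℝ, E) 𝓘(ℝ, E) (g τ) x u := by
  have h := mfderiv_prod_eq_add_apply (p := (τ, x)) (v := (a, u))
    (hp.smooth_action.contMDiffAt.mdifferentiableAt (by simp))
  refine h.trans ?_
  refine congrArg (fun e : TangentSpace 𝓘(ℝ, E) (g τ x) =>
    e + mfderiv 𝓘(ℝ, E) 𝓘(ℝ, E) (g τ) x u) ?_
  refine Eq.trans ?_ (congrArg (fun e : TangentSpace 𝓘(ℝ, E) (g τ x) => a • e)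
    (hp.mfderiv_orbit τ x))
  have h1 := (mfderiv 𝓘(ℝ, ℝ) 𝓘(ℝ, E) (fun τ => g τ x) τ : ℝ →L[ℝ] E).map_smul a (1 : ℝ)
  have h2 : a • (1 : ℝ) = a := by rw [smul_eq_mul, mul_one]
  exact (congrArg (fun c : ℝ => (mfderiv 𝓘(ℝ, ℝ) 𝓘(ℝ, E) (fun τ => g τ x) τ : ℝ →L[ℝ] E) c)
    h2).symm.trans h1

/-- Vectors that correspond under the flow have the same projection. -/
theorem mfderiv_proj_flow (τ : ℝ) (x : M) (u : E) :
    (mfderiv 𝓘(ℝ, E) 𝓘(ℝ, F) p (g τ x) (mfderiv 𝓘(ℝ, E) 𝓘(ℝ, E) (g τ) x u : E) : F) =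
      mfderiv 𝓘(ℝ, E) 𝓘(ℝ, F) p x u := by
  have h1 : p ∘ g τ = p := by funext y; exact hp.proj_flow τ y
  have h2 := mfderiv_comp x (hp.mdifferentiableAt_proj (g τ x)) (hp.mdifferentiableAt_flow τ x)
  rw [h1] at h2
  exact (congrArg (fun L : E →L[ℝ] F => L u) h2).symm

theorem mfderiv_proj_generator (x : M) :
    (mfderiv 𝓘(ℝ, E) 𝓘(ℝ, F) p x (generator E g x) : F) = 0 := by
  have h1 : p ∘ (fun τ => g τ x) = fun _ => p x := by funext τ; exact hp.proj_flow τ x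
  have h2 := mfderiv_comp (0 : ℝ) (hp.mdifferentiableAt_proj (g 0 x))
    (hp.mdifferentiableAt_orbit x 0)
  rw [h1, mfderiv_const] at h2
  have h3 : (mfderiv 𝓘(ℝ, E) 𝓘(ℝ, F) p (g 0 x) : E →L[ℝ] F) =
      mfderiv 𝓘(ℝ, E) 𝓘(ℝ, F) p x := by rw [hp.zero]
  have h4 := congrArg (fun L : ℝ →L[ℝ] F => L 1) h2
  exact (h4.trans (congrArg (fun L : E →L[ℝ] F => L (generator E g x)) h3)).symm

theorem mfderiv_flow_neg_flow (τ : ℝ) (x : M) (u : E) :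
    (mfderiv 𝓘(ℝ, E) 𝓘(ℝ, E) (g τ) x
      (mfderiv 𝓘(ℝ, E) 𝓘(ℝ, E) (g (-τ)) (g τ x) u : E) : E) = u := by
  have h1 : g τ ∘ g (-τ) = id := by funext y; exact hp.flow_flow_neg τ y
  have h2 := mfderiv_comp (g τ x) (hp.mdifferentiableAt_flow τ (g (-τ) (g τ x)))
    (hp.mdifferentiableAt_flow (-τ) (g τ x))
  rw [h1, mfderiv_id] at h2
  have h3 : (mfderiv 𝓘(ℝ, E) 𝓘(ℝ, E) (g τ) (g (-τ) (g τ x)) : E →L[ℝ] E) =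
      mfderiv 𝓘(ℝ, E) 𝓘(ℝ, E) (g τ) x := by rw [hp.flow_neg_flow]
  have h4 := congrArg (fun L : E →L[ℝ] E => L u) h2
  exact (h4.trans (congrArg (fun L : E →L[ℝ] E =>
    L (mfderiv 𝓘(ℝ, E) 𝓘(ℝ, E) (g (-τ)) (g τ x) u)) h3)).symm

end

omit [IsManifold 𝓘(ℝ, F) ∞ B] in
/-- The generating field is the image of the field `(1, 0)` along `{0} × M` under the tangent map of
the action, hence smooth. -/
theorem contMDiff_generator (hp : IsPrincipalFlowBundle E F g p) :
    ContMDiff 𝓘(ℝ, E) 𝓘(ℝ, E).tangent ∞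
      (fun x => (⟨x, generator E g x⟩ : TangentBundle 𝓘(ℝ, E) M)) := by
  have h1 : ContMDiff 𝓘(ℝ, E) (𝓘(ℝ, ℝ).tangent.prod 𝓘(ℝ, E).tangent) ∞
      (fun x : M => ((⟨0, (1 : ℝ)⟩, ⟨x, 0⟩) :
        TangentBundle 𝓘(ℝ, ℝ) ℝ × TangentBundle 𝓘(ℝ, E) M)) :=
    contMDiff_const.prodMk (Bundle.contMDiff_zeroSection ℝ (TangentSpace 𝓘(ℝ, E) : M → Type _))
  have h2 := (contMDiff_equivTangentBundleProd_symm (I := 𝓘(ℝ, ℝ)) (I' := 𝓘(ℝ, E)) (M := ℝ)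
    (M' := M) (n := ∞)).comp h1
  have h3 := (hp.smooth_action.contMDiff_tangentMap (m := ∞) le_rfl).comp h2
  refine h3.congr fun x => ?_
  have h4 := hp.mfderiv_action 0 x 1 0
  have h5 : (generator E g x : E) = mfderiv (𝓘(ℝ, ℝ).prod 𝓘(ℝ, E)) 𝓘(ℝ, E)
      (fun q : ℝ × M => g q.1 q.2) (0, x) ((1 : ℝ), (0 : E)) := by
    rw [h4, one_smul, hp.zero]
    exact ((congrArg _ (map_zero (mfderiv 𝓘(ℝ, E) 𝓘(ℝ, E) (g 0) x))).trans (add_zero _)).symm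
  exact (congrArg (fun u : E => (⟨x, u⟩ : TangentBundle 𝓘(ℝ, E) M)) h5).trans
    (TangentBundle.mk_congr (hp.zero x).symm _)

end IsPrincipalFlowBundle
end Flow

/-! ### Flow sections -/

section FlowSection

variable {E : Type*} [NormedAddCommGroup E] [NormedSpace ℝ E]
  {M : Type*} [TopologicalSpace M] [ChartedSpace E M]
  {F : Type*} [NormedAddCommGroup F] [NormedSpace ℝ F]
  {B : Type*} [TopologicalSpace B] [ChartedSpace F B]
  {g : ℝ → M → M} {p : M → B}

variable (E F) in
/-- A smooth section `s` of `p` over an open set `U`, such that the flow of the section is a local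
diffeomorphism. -/
structure IsFlowSection (g : ℝ → M → M) (p : M → B) (U : Set B) (s : B → M) : Prop where
  isOpen : IsOpen U
  contMDiffOn : ContMDiffOn 𝓘(ℝ, F) 𝓘(ℝ, E) ∞ s U
  proj_eq : ∀ u ∈ U, p (s u) = u
  isLocalDiffeomorphOn : IsLocalDiffeomorphOn (𝓘(ℝ, F).prod 𝓘(ℝ, ℝ)) 𝓘(ℝ, E) ∞
    (fun q : B × ℝ => g q.2 (s q.1)) (U ×ˢ univ)

theorem IsPrincipalFlowBundle.exists_flowSection (hp : IsPrincipalFlowBundle E F g p) (b : B) :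
    ∃ U s, b ∈ U ∧ IsFlowSection E F g p U s := by
  obtain ⟨U, hU, hb, s, hs, hps, hloc⟩ := hp.locallyTrivial b
  exact ⟨U, s, hb, hU, hs, hps, hloc⟩

namespace IsFlowSection

variable {U : Set B} {s : B → M} (hs : IsFlowSection E F g p U s)
include hs

theorem contMDiffAt {b : B} (hb : b ∈ U) : ContMDiffAt 𝓘(ℝ, F) 𝓘(ℝ, E) ∞ s b :=
  hs.contMDiffOn.contMDiffAt (hs.isOpen.mem_nhds hb)

theorem mdifferentiableAt {b : B} (hb : b ∈ U) : MDifferentiableAt 𝓘(ℝ, F) 𝓘(ℝ, E) s b :=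
  (hs.contMDiffAt hb).mdifferentiableAt (by simp)

theorem exists_flow_eq (hp : IsPrincipalFlowBundle E F g p) {x : M} (hx : p x ∈ U) :
    ∃ τ, g τ (s (p x)) = x :=
  (hp.fiber _ _).1 (hs.proj_eq _ hx)

/-- Near every point `x` over `U`, the flow time needed to reach a point from the section is a
smooth function. -/
theorem exists_time (hp : IsPrincipalFlowBundle E F g p) {x : M} (hx : p x ∈ U) :
    ∃ t : M → ℝ, ∀ᶠ y in 𝓝 x, ContMDiffAt 𝓘(ℝ, E) 𝓘(ℝ, ℝ) ∞ t y ∧ p y ∈ U ∧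
      g (t y) (s (p y)) = y := by
  obtain ⟨τ, hτ⟩ := hs.exists_flow_eq hp hx
  have hl := hs.isLocalDiffeomorphOn ⟨(p x, τ), hx, trivial⟩
  have hxs : x ∈ hl.localInverse.source := by
    have := hl.localInverse_mem_source
    simpa only [hτ] using this
  have hmem := hl.localInverse.open_source.mem_nhds hxs
  have hsm := hl.localInverse_contMDiffOn
  have hleft : hl.localInverse x = (p x, τ) := by
    have := hl.localInverse_left_inv hl.localInverse_mem_target
    simpa only [hτ] using this
  have hev : ∀ᶠ y in 𝓝 x, (hl.localInverse y).1 ∈ U := by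
    have hc : ContinuousAt hl.localInverse x := (hsm.contMDiffAt hmem).continuousAt
    have : ∀ᶠ q : B × ℝ in 𝓝 (hl.localInverse x), q.1 ∈ U := by
      rw [hleft]
      exact continuous_fst.continuousAt.eventually (hs.isOpen.mem_nhds hx)
    exact hc.eventually this
  refine ⟨fun y => (hl.localInverse y).2, ?_⟩
  filter_upwards [hev, hmem] with y hyU hy
  have h1 : g (hl.localInverse y).2 (s (hl.localInverse y).1) = y := hl.localInverse_right_inv hy
  have h2 : p y = (hl.localInverse y).1 := by
    conv_lhs => rw [← h1]
    rw [hp.proj_flow, hs.proj_eq _ hyU]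
  refine ⟨(hsm.contMDiffAt (hl.localInverse.open_source.mem_nhds hy)).snd, ?_, ?_⟩
  · rwa [h2]
  · rw [h2]; exact h1

/-- The splitting of a tangent vector into its part along the orbit and the transport of its part
along the section. -/
theorem decomposition (hp : IsPrincipalFlowBundle E F g p) {t : M → ℝ} {x : M}
    (ht : ∀ᶠ y in 𝓝 x, ContMDiffAt 𝓘(ℝ, E) 𝓘(ℝ, ℝ) ∞ t y ∧ p y ∈ U ∧
      g (t y) (s (p y)) = y) (Y : TangentSpace 𝓘(ℝ, E) x) :
    (Y : E) = (diffAt 𝓘(ℝ, E) t x Y • generator E g (g (t x) (s (p x))) +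
      mfderiv 𝓘(ℝ, E) 𝓘(ℝ, E) (g (t x)) (s (p x)) (mfderiv 𝓘(ℝ, E) 𝓘(ℝ, E) (s ∘ p) x Y) :
      TangentSpace 𝓘(ℝ, E) (g (t x) (s (p x)))) := by
  have htx := ht.self_of_nhds
  have h1 : (fun q : ℝ × M => g q.1 q.2) ∘ (fun y => (t y, (s ∘ p) y)) =ᶠ[𝓝 x] id :=
    ht.mono fun y hy => hy.2.2
  have htd : MDifferentiableAt 𝓘(ℝ, E) 𝓘(ℝ, ℝ) t x := htx.1.mdifferentiableAt (by simp)
  have hsp : MDifferentiableAt 𝓘(ℝ, E) 𝓘(ℝ, E) (s ∘ p) x :=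
    (hs.mdifferentiableAt htx.2.1).comp x (hp.mdifferentiableAt_proj x)
  have h2 := mfderiv_comp x (g := fun q : ℝ × M => g q.1 q.2) (f := fun y => (t y, (s ∘ p) y))
    (I' := 𝓘(ℝ, ℝ).prod 𝓘(ℝ, E))
    (hp.smooth_action.contMDiffAt.mdifferentiableAt (by simp)) (htd.prodMk hsp)
  have h3 := h1.mfderiv_eq (I := 𝓘(ℝ, E)) (I' := 𝓘(ℝ, E))
  rw [mfderiv_id] at h3
  have h4 := congrArg (fun L : E →L[ℝ] E => L Y) (h3.symm.trans h2)
  refine h4.trans ?_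
  have h5 := mfderiv_prodMk htd hsp
  refine Eq.trans ?_ (hp.mfderiv_action (t x) (s (p x)) (diffAt 𝓘(ℝ, E) t x Y)
    (mfderiv 𝓘(ℝ, E) 𝓘(ℝ, E) (s ∘ p) x Y))
  exact congrArg (fun L : E →L[ℝ] ℝ × E => (mfderiv (𝓘(ℝ, ℝ).prod 𝓘(ℝ, E)) 𝓘(ℝ, E)
    (fun q : ℝ × M => g q.1 q.2) (t x, s (p x)) (L Y) : E)) h5

theorem finrank_eq [FiniteDimensional ℝ F] {b : B}
    (hb : b ∈ U) : Module.finrank ℝ E = Module.finrank ℝ F + 1 := by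
  have hl := hs.isLocalDiffeomorphOn ⟨(b, 0), hb, trivial⟩
  have e : (F × ℝ) ≃L[ℝ] E := hl.mfderivToContinuousLinearEquiv (by simp)
  rw [← e.toLinearEquiv.finrank_eq]
  simp

/-- The generating field is the image of `(0, 1)` under the derivative of a local diffeomorphism. -/
theorem generator_ne_zero (hp : IsPrincipalFlowBundle E F g p) {x : M} (hx : p x ∈ U) :
    generator E g x ≠ 0 := by
  obtain ⟨τ, hτ⟩ := hs.exists_flow_eq hp hx
  have hl := hs.isLocalDiffeomorphOn ⟨(p x, τ), hx, trivial⟩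
  let e := hl.mfderivToContinuousLinearEquiv (by simp)
  have h1 : (e ((0 : F), (1 : ℝ)) : E) = (generator E g (g τ (s (p x))) : E) := by
    rw [← hp.mfderiv_orbit]
    have h2 := mfderiv_comp τ (g := fun q : B × ℝ => g q.2 (s q.1)) (f := fun τ => (p x, τ))
      (I' := 𝓘(ℝ, F).prod 𝓘(ℝ, ℝ))
      (hl.mdifferentiableAt (by simp)) (mdifferentiableAt_const.prodMk mdifferentiableAt_id)
    have h3 := congrArg (fun L : ℝ →L[ℝ] E => L 1) h2
    refine Eq.trans ?_ h3.symm
    have h4 := mfderiv_prod_right (I := 𝓘(ℝ, F)) (I' := 𝓘(ℝ, ℝ)) (x₀ := p x) (y₀ := τ)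
    exact (congrArg (fun L : ℝ →L[ℝ] F × ℝ => (e (L 1) : E)) h4).symm
  intro h0
  rw [hτ] at h1
  have h5 : e ((0 : F), (1 : ℝ)) = 0 := h1.trans h0
  have h6 := e.map_eq_zero_iff.1 h5
  exact one_ne_zero (congrArg Prod.snd h6 : (1 : ℝ) = 0)

theorem mfderiv_proj_mfderiv (hp : IsPrincipalFlowBundle E F g p) {b : B} (hb : b ∈ U) (f : F) :
    (mfderiv 𝓘(ℝ, E) 𝓘(ℝ, F) p (s b) (mfderiv 𝓘(ℝ, F) 𝓘(ℝ, E) s b f) : F) = f := by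
  have h1 : p ∘ s =ᶠ[𝓝 b] id := by
    filter_upwards [hs.isOpen.mem_nhds hb] with u hu using hs.proj_eq u hu
  have h2 := mfderiv_comp b (hp.mdifferentiableAt_proj (s b)) (hs.mdifferentiableAt hb)
  have h3 := h1.mfderiv_eq (I := 𝓘(ℝ, F)) (I' := 𝓘(ℝ, F))
  rw [mfderiv_id] at h3
  exact congrArg (fun L : F →L[ℝ] F => L f) (h2.symm.trans h3)

end IsFlowSection

namespace IsPrincipalFlowBundle
variable (hp : IsPrincipalFlowBundle E F g p)
include hp

theorem generator_ne_zero (x : M) : generator E g x ≠ 0 := by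
  obtain ⟨U, s, hx, hs⟩ := hp.exists_flowSection (p x)
  exact hs.generator_ne_zero hp hx

theorem finrank_eq [FiniteDimensional ℝ F] (b : B) :
    Module.finrank ℝ E = Module.finrank ℝ F + 1 := by
  obtain ⟨U, s, hx, hs⟩ := hp.exists_flowSection b
  exact hs.finrank_eq hx

theorem mfderiv_proj_surjective (x : M) :
    Function.Surjective (mfderiv 𝓘(ℝ, E) 𝓘(ℝ, F) p x) := by
  obtain ⟨U, s, hx, hs⟩ := hp.exists_flowSection (p x)
  obtain ⟨τ, hτ⟩ := hs.exists_flow_eq hp hx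
  intro f
  refine ⟨(mfderiv 𝓘(ℝ, E) 𝓘(ℝ, E) (g τ) (s (p x)) (mfderiv 𝓘(ℝ, F) 𝓘(ℝ, E) s (p x) f) : E), ?_⟩
  have h1 := hp.mfderiv_proj_flow τ (s (p x)) (mfderiv 𝓘(ℝ, F) 𝓘(ℝ, E) s (p x) f)
  have h2 : (mfderiv 𝓘(ℝ, E) 𝓘(ℝ, F) p (g τ (s (p x))) : E →L[ℝ] F) =
      mfderiv 𝓘(ℝ, E) 𝓘(ℝ, F) p x := by rw [hτ]
  exact (congrArg (fun L : E →L[ℝ] F => L (mfderiv 𝓘(ℝ, E) 𝓘(ℝ, E) (g τ) (s (p x))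
    (mfderiv 𝓘(ℝ, F) 𝓘(ℝ, E) s (p x) f))) h2).symm.trans
      (h1.trans (hs.mfderiv_proj_mfderiv hp hx f))

/-- The vertical vectors are the multiples of the generating field. -/
theorem exists_eq_smul_generator {x : M} {Y : TangentSpace 𝓘(ℝ, E) x}
    (hY : mfderiv 𝓘(ℝ, E) 𝓘(ℝ, F) p x Y = 0) : ∃ c : ℝ, Y = c • generator E g x := by
  obtain ⟨U, s, hx, hs⟩ := hp.exists_flowSection (p x)
  obtain ⟨t, ht⟩ := hs.exists_time hp hx
  refine ⟨diffAt 𝓘(ℝ, E) t x Y, ?_⟩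
  have h1 := hs.decomposition hp ht Y
  have h2 := mfderiv_comp x (hs.mdifferentiableAt hx) (hp.mdifferentiableAt_proj x)
  have h3 : mfderiv 𝓘(ℝ, E) 𝓘(ℝ, E) (s ∘ p) x Y = 0 := by
    refine (congrArg (fun L : E →L[ℝ] E => L Y) h2).trans ?_
    exact (congrArg (mfderiv 𝓘(ℝ, F) 𝓘(ℝ, E) s (p x)) hY).trans (map_zero _)
  have h4 : mfderiv 𝓘(ℝ, E) 𝓘(ℝ, E) (g (t x)) (s (p x))
      (mfderiv 𝓘(ℝ, E) 𝓘(ℝ, E) (s ∘ p) x Y) = 0 :=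
    (congrArg (mfderiv 𝓘(ℝ, E) 𝓘(ℝ, E) (g (t x)) (s (p x))) h3).trans (map_zero _)
  rw [h4, add_zero, ht.self_of_nhds.2.2] at h1
  exact h1

end IsPrincipalFlowBundle
end FlowSection

/-! ### The transverse form -/

section ReducedMetric

variable {E : Type*} [NormedAddCommGroup E] [NormedSpace ℝ E]
  {M : Type*} [TopologicalSpace M] [ChartedSpace E M] [IsManifold 𝓘(ℝ, E) ∞ M]
  {F : Type*} [NormedAddCommGroup F] [NormedSpace ℝ F]
  {B : Type*} [TopologicalSpace B] [ChartedSpace F B]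
  {g : ℝ → M → M} {p : M → B}

/-- The metric evaluated on the components orthogonal to the generating field. -/
noncomputable def transverseForm (m : RiemMetric E M) (g : ℝ → M → M) (x : M) :
    TangentSpace 𝓘(ℝ, E) x →L[ℝ] TangentSpace 𝓘(ℝ, E) x →L[ℝ] ℝ :=
  m.inner x - (m.inner x (generator E g x) (generator E g x))⁻¹ •
    (m.inner x (generator E g x)).smulRight (m.inner x (generator E g x))

theorem transverseForm_apply (m : RiemMetric E M) (x : M) (u w : TangentSpace 𝓘(ℝ, E) x) :
    transverseForm m g x u w = m.inner x u w -
      (m.inner x (generator E g x) (generator E g x))⁻¹ *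
        (m.inner x (generator E g x) u * m.inner x (generator E g x) w) := rfl

theorem inner_generator_pos (m : RiemMetric E M) (hp : IsPrincipalFlowBundle E F g p) (x : M) :
    0 < m.inner x (generator E g x) (generator E g x) :=
  m.pos x _ (hp.generator_ne_zero x)

theorem transverseForm_add_smul_generator (m : RiemMetric E M)
    (hp : IsPrincipalFlowBundle E F g p) (x : M) (u w : TangentSpace 𝓘(ℝ, E) x) (a b : ℝ) :
    transverseForm m g x (u + a • generator E g x) (w + b • generator E g x) =
      transverseForm m g x u w := by
  have h := (inner_generator_pos m hp x).ne'
  rw [transverseForm_apply, transverseForm_apply]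
  simp only [map_add, map_smul, add_apply, smul_apply, smul_eq_mul]
  rw [m.symm x u (generator E g x)]
  field_simp
  ring

section Invariance
variable {m : RiemMetric E M} (hgm : PreservesMetric m g)
include hgm

theorem inner_generator_flow (hp : IsPrincipalFlowBundle E F g p) (τ : ℝ) (x : M)
    (u : TangentSpace 𝓘(ℝ, E) x) :
    m.inner (g τ x) (generator E g (g τ x)) (mfderiv 𝓘(ℝ, E) 𝓘(ℝ, E) (g τ) x u) =
      m.inner x (generator E g x) u := by
  rw [← hgm τ x]
  exact congrArg (fun v : TangentSpace 𝓘(ℝ, E) (g τ x) =>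
    m.inner (g τ x) v (mfderiv 𝓘(ℝ, E) 𝓘(ℝ, E) (g τ) x u)) (hp.mfderiv_flow_generator τ x).symm

theorem inner_generator_generator_flow (hp : IsPrincipalFlowBundle E F g p) (τ : ℝ) (x : M) :
    m.inner (g τ x) (generator E g (g τ x)) (generator E g (g τ x)) =
      m.inner x (generator E g x) (generator E g x) := by
  rw [← inner_generator_flow hgm hp τ x]
  exact congrArg (fun v : TangentSpace 𝓘(ℝ, E) (g τ x) =>
    m.inner (g τ x) (generator E g (g τ x)) v) (hp.mfderiv_flow_generator τ x).symm

theorem transverseForm_flow (hp : IsPrincipalFlowBundle E F g p) (τ : ℝ) (x : M)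
    (u w : TangentSpace 𝓘(ℝ, E) x) :
    transverseForm m g (g τ x) (mfderiv 𝓘(ℝ, E) 𝓘(ℝ, E) (g τ) x u)
      (mfderiv 𝓘(ℝ, E) 𝓘(ℝ, E) (g τ) x w) = transverseForm m g x u w := by
  rw [transverseForm_apply, transverseForm_apply, hgm, inner_generator_flow hgm hp,
    inner_generator_flow hgm hp, inner_generator_generator_flow hgm hp]

/-- The transverse form descends to the base: its values depend only on the projected vectors. -/
theorem transverseForm_eq_of_proj_eq (hp : IsPrincipalFlowBundle E F g p) {x x' : M}
    (hx : p x' = p x) {u w : TangentSpace 𝓘(ℝ, E) x} {u' w' : TangentSpace 𝓘(ℝ, E) x'}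
    (hu : (mfderiv 𝓘(ℝ, E) 𝓘(ℝ, F) p x u : F) = mfderiv 𝓘(ℝ, E) 𝓘(ℝ, F) p x' u')
    (hw : (mfderiv 𝓘(ℝ, E) 𝓘(ℝ, F) p x w : F) = mfderiv 𝓘(ℝ, E) 𝓘(ℝ, F) p x' w') :
    transverseForm m g x u w = transverseForm m g x' u' w' := by
  obtain ⟨τ, rfl⟩ := (hp.fiber _ _).1 hx
  -- Vectors with the same projection agree up to the flow and a multiple of the generating field.
  have key : ∀ (u : TangentSpace 𝓘(ℝ, E) (g τ x')) (u' : TangentSpace 𝓘(ℝ, E) x'),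
      (mfderiv 𝓘(ℝ, E) 𝓘(ℝ, F) p (g τ x') u : F) = mfderiv 𝓘(ℝ, E) 𝓘(ℝ, F) p x' u' →
      ∃ c : ℝ, u = mfderiv 𝓘(ℝ, E) 𝓘(ℝ, E) (g τ) x' (u' + c • generator E g x') := by
    intro u u' h
    obtain ⟨u₁, hu₁⟩ : ∃ u₁ : TangentSpace 𝓘(ℝ, E) x',
        mfderiv 𝓘(ℝ, E) 𝓘(ℝ, E) (g τ) x' u₁ = u := ⟨_, hp.mfderiv_flow_neg_flow τ x' u⟩
    have h2 : (mfderiv 𝓘(ℝ, E) 𝓘(ℝ, F) p x' u₁ : F) = mfderiv 𝓘(ℝ, E) 𝓘(ℝ, F) p x' u' := by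
      refine ((hp.mfderiv_proj_flow τ x' u₁).symm.trans ?_).trans h
      exact congrArg (mfderiv 𝓘(ℝ, E) 𝓘(ℝ, F) p (g τ x')) hu₁
    obtain ⟨c, hc⟩ := hp.exists_eq_smul_generator (x := x') (Y := u₁ - u') (by
        rw [map_sub]; exact sub_eq_zero.2 h2)
    refine ⟨c, hu₁.symm.trans ?_⟩
    rw [← hc, add_sub_cancel]
  obtain ⟨c, rfl⟩ := key u u' hu
  obtain ⟨d, rfl⟩ := key w w' hw
  rw [transverseForm_flow hgm hp, transverseForm_add_smul_generator m hp]

end Invariance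
end ReducedMetric

/-! ### The reduced metric -/

section ReducedMetric

variable {E : Type*} [NormedAddCommGroup E] [NormedSpace ℝ E]
  {M : Type*} [TopologicalSpace M] [ChartedSpace E M] [IsManifold 𝓘(ℝ, E) ∞ M]
  {F : Type*} [NormedAddCommGroup F] [NormedSpace ℝ F] [FiniteDimensional ℝ F]
  {B : Type*} [TopologicalSpace B] [ChartedSpace F B] [IsManifold 𝓘(ℝ, F) ∞ B]
  {g : ℝ → M → M} {p : M → B}

omit [FiniteDimensional ℝ F] [IsManifold 𝓘(ℝ, F) ∞ B] in
theorem contMDiffAt_transverseForm (m : RiemMetric E M) (hp : IsPrincipalFlowBundle E F g p)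
    {EZ : Type*} [NormedAddCommGroup EZ] [NormedSpace ℝ EZ]
    {HZ : Type*} [TopologicalSpace HZ] {IZ : ModelWithCorners ℝ EZ HZ}
    {Z : Type*} [TopologicalSpace Z] [ChartedSpace HZ Z] {b : Z → M}
    {u w : ∀ z, TangentSpace 𝓘(ℝ, E) (b z)} {z₀ : Z}
    (hu : ContMDiffAt IZ 𝓘(ℝ, E).tangent ∞ (fun z => (⟨b z, u z⟩ : TangentBundle 𝓘(ℝ, E) M)) z₀)
    (hw : ContMDiffAt IZ 𝓘(ℝ, E).tangent ∞ (fun z => (⟨b z, w z⟩ : TangentBundle 𝓘(ℝ, E) M)) z₀) :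
    ContMDiffAt IZ 𝓘(ℝ, ℝ) ∞ (fun z => transverseForm m g (b z) (u z) (w z)) z₀ := by
  have hb : ContMDiffAt IZ 𝓘(ℝ, E) ∞ b z₀ := contMDiff_proj_tangentBundle.contMDiffAt.comp z₀ hu
  have hv : ContMDiffAt IZ 𝓘(ℝ, E).tangent ∞
      (fun z => (⟨b z, generator E g (b z)⟩ : TangentBundle 𝓘(ℝ, E) M)) z₀ :=
    hp.contMDiff_generator.contMDiffAt.comp z₀ hb
  simp only [transverseForm_apply]
  exact (m.contMDiffAt_inner hu hw).sub (((m.contMDiffAt_inner hv hv).inv₀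
    (inner_generator_pos m hp (b z₀)).ne').mul
      ((m.contMDiffAt_inner hv hu).mul (m.contMDiffAt_inner hv hw)))

omit [FiniteDimensional ℝ F] [IsManifold 𝓘(ℝ, F) ∞ B] in
/-- Tangent vectors of the base lift to vectors with any prescribed momentum. -/
theorem IsPrincipalFlowBundle.exists_horizontal (m : RiemMetric E M)
    (hp : IsPrincipalFlowBundle E F g p) (x : M) (f : TangentSpace 𝓘(ℝ, F) (p x)) (k : ℝ) :
    ∃ u : TangentSpace 𝓘(ℝ, E) x, mfderiv 𝓘(ℝ, E) 𝓘(ℝ, F) p x u = f ∧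
      m.inner x (generator E g x) u = k := by
  obtain ⟨u, hu⟩ := hp.mfderiv_proj_surjective x f
  refine ⟨u + ((m.inner x (generator E g x) (generator E g x))⁻¹ *
    (k - m.inner x (generator E g x) u)) • generator E g x, ?_, ?_⟩
  · rw [map_add, map_smul, hu]
    have := hp.mfderiv_proj_generator x
    exact (congrArg (fun e : TangentSpace 𝓘(ℝ, F) (p x) => f + _ • e) this).trans (by simp)
  · have := (inner_generator_pos m hp x).ne'
    rw [map_add, map_smul, smul_eq_mul]
    field_simp
    ring

/-- The reduced metric on the base, pulled back to the total space, is the transverse form. -/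
theorem exists_reducedMetric {m : RiemMetric E M} (hgm : PreservesMetric m g)
    (hp : IsPrincipalFlowBundle E F g p) :
    ∃ m' : RiemMetric F B, ∀ (x : M) (w₁ w₂ : TangentSpace 𝓘(ℝ, E) x),
      m'.inner (p x) (mfderiv 𝓘(ℝ, E) 𝓘(ℝ, F) p x w₁) (mfderiv 𝓘(ℝ, E) 𝓘(ℝ, F) p x w₂) =
        transverseForm m g x w₁ w₂ := by
  -- Pull the transverse form back along arbitrary linear lifts `R b` at arbitrary points `σ b` over
  -- `b`; the result depends on no choice, so that it is smooth because smooth sections exist.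
  let σ : B → M := Function.surjInv hp.surjective
  have hσ : ∀ b, p (σ b) = b := Function.surjInv_eq hp.surjective
  have hR : ∀ b, ∃ R : F →L[ℝ] E, ∀ f : F, (mfderiv 𝓘(ℝ, E) 𝓘(ℝ, F) p (σ b) (R f) : F) = f := by
    intro b
    let L : E →L[ℝ] F := mfderiv 𝓘(ℝ, E) 𝓘(ℝ, F) p (σ b)
    obtain ⟨R, hR⟩ := ContinuousLinearMap.exists_rightInverse_of_surjective L
      (LinearMap.range_eq_top.2 (hp.mfderiv_proj_surjective (σ b)))
    exact ⟨R, fun f => congrArg (fun L : F →L[ℝ] F => L f) hR⟩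
  choose R hR using hR
  let G : ∀ b : B, TangentSpace 𝓘(ℝ, F) b →L[ℝ] TangentSpace 𝓘(ℝ, F) b →L[ℝ] ℝ := fun b =>
    let Q : E →L[ℝ] E →L[ℝ] ℝ := transverseForm m g (σ b)
    let Q' : F →L[ℝ] F →L[ℝ] ℝ := Q.bilinearComp (R b) (R b)
    Q'
  have hG : ∀ (x : M) (b : B) (w₁ w₂ : TangentSpace 𝓘(ℝ, E) x) (f₁ f₂ : TangentSpace 𝓘(ℝ, F) b),
      p x = b → (mfderiv 𝓘(ℝ, E) 𝓘(ℝ, F) p x w₁ : F) = f₁ →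
      (mfderiv 𝓘(ℝ, E) 𝓘(ℝ, F) p x w₂ : F) = f₂ → G b f₁ f₂ = transverseForm m g x w₁ w₂ := by
    intro x b w₁ w₂ f₁ f₂ hx h₁ h₂
    exact transverseForm_eq_of_proj_eq hgm hp (hx.trans (hσ b).symm)
      ((hR b f₁).trans h₁.symm) ((hR b f₂).trans h₂.symm)
  have hlift : ∀ (b : B) (f : TangentSpace 𝓘(ℝ, F) b), ∃ u : TangentSpace 𝓘(ℝ, E) (σ b),
      (mfderiv 𝓘(ℝ, E) 𝓘(ℝ, F) p (σ b) u : F) = f ∧ G b f f = m.inner (σ b) u u := by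
    intro b f
    obtain ⟨u, hu, hu0⟩ := hp.exists_horizontal m (σ b) (f : F) 0
    refine ⟨u, hu, ?_⟩
    rw [hG (σ b) b u u f f (hσ b) hu hu, transverseForm_apply, hu0]
    simp
  refine ⟨⟨G, ?_, ?_, ?_, contMDiff_bilinear_of_apply ?_⟩, ?_⟩
  · intro b f₁ f₂
    obtain ⟨u₁, h₁, -⟩ := hlift b f₁
    obtain ⟨u₂, h₂, -⟩ := hlift b f₂
    rw [hG _ b u₁ u₂ f₁ f₂ (hσ b) h₁ h₂, hG _ b u₂ u₁ f₂ f₁ (hσ b) h₂ h₁, transverseForm_apply,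
      transverseForm_apply, m.symm, mul_comm (m.inner (σ b) (generator E g (σ b)) u₁)]
  · intro b f hf
    obtain ⟨u, hu, hG'⟩ := hlift b f
    rw [hG']
    refine m.pos _ _ fun h0 => hf ?_
    subst h0
    exact hu.symm.trans (map_zero _)
  · -- The unit ball of the reduced metric is covered by the projection of the unit ball upstairs.
    intro b
    have h := (m.isVonNBounded (σ b)).image (mfderiv 𝓘(ℝ, E) 𝓘(ℝ, F) p (σ b))
    refine Bornology.IsVonNBounded.subset ?_ h
    intro f hf
    obtain ⟨u, hu, hG'⟩ := hlift b f
    exact ⟨u, hG'.symm.trans_lt hf, hu⟩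
  · intro b₀ X Y hX hY
    obtain ⟨U, s, hb, hs⟩ := hp.exists_flowSection b₀
    have h1 := (ContMDiffAt.tangentMap_infty (w := (⟨b₀, X b₀⟩ : TangentBundle 𝓘(ℝ, F) B))
      (hs.contMDiffAt hb)).comp b₀ hX
    have h2 := (ContMDiffAt.tangentMap_infty (w := (⟨b₀, Y b₀⟩ : TangentBundle 𝓘(ℝ, F) B))
      (hs.contMDiffAt hb)).comp b₀ hY
    have h3 := contMDiffAt_transverseForm m hp (b := s) h1 h2
    refine h3.congr_of_eventuallyEq ?_
    filter_upwards [hs.isOpen.mem_nhds hb] with b hb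
    exact hG (s b) b _ _ _ _ (hs.proj_eq b hb) (hs.mfderiv_proj_mfderiv hp hb (X b))
      (hs.mfderiv_proj_mfderiv hp hb (Y b))
  · intro x w₁ w₂
    exact hG x (p x) w₁ w₂ _ _ rfl rfl rfl

omit [FiniteDimensional ℝ F] in
/-- The metric induced by the transverse form is the only reduced metric, as every tangent vector of
the base has a lift orthogonal to the generating field. -/
theorem isReducedMetric_iff (m : RiemMetric E M) (hp : IsPrincipalFlowBundle E F g p)
    {m' : RiemMetric F B} (hm' : ∀ (x : M) (w₁ w₂ : TangentSpace 𝓘(ℝ, E) x),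
      m'.inner (p x) (mfderiv 𝓘(ℝ, E) 𝓘(ℝ, F) p x w₁) (mfderiv 𝓘(ℝ, E) 𝓘(ℝ, F) p x w₂) =
        transverseForm m g x w₁ w₂) (n : RiemMetric F B) :
    IsReducedMetric m g p n ↔ n = m' := by
  have h0 : IsReducedMetric m g p m' := by
    intro x w₁ w₂ h₁ h₂
    rw [hm', transverseForm_apply, h₁]
    simp
  refine ⟨fun hn => ?_, fun h => h ▸ h0⟩
  have : n.inner = m'.inner := by
    funext b
    obtain ⟨x, rfl⟩ := hp.surjective b
    refine ContinuousLinearMap.ext fun f₁ => ContinuousLinearMap.ext fun f₂ => ?_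
    obtain ⟨u₁, rfl, h₁⟩ := hp.exists_horizontal m x f₁ 0
    obtain ⟨u₂, rfl, h₂⟩ := hp.exists_horizontal m x f₂ 0
    rw [hn x u₁ u₂ h₁ h₂, h0 x u₁ u₂ h₁ h₂]
  cases n; cases m'; cases this; rfl

end ReducedMetric

/-! ### Energy, momentum and the amended potential -/

section Energy

variable {E : Type*} [NormedAddCommGroup E] [NormedSpace ℝ E]
  {M : Type*} [TopologicalSpace M] [ChartedSpace E M] [IsManifold 𝓘(ℝ, E) ∞ M]
  {F : Type*} [NormedAddCommGroup F] [NormedSpace ℝ F]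
  {B : Type*} [TopologicalSpace B] [ChartedSpace F B]
  {g : ℝ → M → M} {p : M → B}

theorem contMDiff_totalEnergy (m : RiemMetric E M) {V : M → ℝ}
    (hV : ContMDiff 𝓘(ℝ, E) 𝓘(ℝ, ℝ) ∞ V) :
    ContMDiff 𝓘(ℝ, E).tangent 𝓘(ℝ, ℝ) ∞ (totalEnergy m V) := by
  intro w
  refine ContMDiffAt.add (contMDiffAt_const.mul (m.contMDiffAt_inner (b := fun w : TangentBundle 𝓘(ℝ, E) M => w.proj)
    (v := fun w => w.2) (w := fun w => w.2) contMDiffAt_id contMDiffAt_id)) ?_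
  exact hV.contMDiffAt.comp w contMDiff_proj_tangentBundle.contMDiffAt

theorem contMDiff_momentum (m : RiemMetric E M) (hp : IsPrincipalFlowBundle E F g p) :
    ContMDiff 𝓘(ℝ, E).tangent 𝓘(ℝ, ℝ) ∞ (momentum m g) := fun w =>
  m.contMDiffAt_inner (b := fun w : TangentBundle 𝓘(ℝ, E) M => w.proj)
    (v := fun w => generator E g w.proj)
    (w := fun w => w.2)
    (hp.contMDiff_generator.contMDiffAt.comp w contMDiff_proj_tangentBundle.contMDiffAt)
    contMDiffAt_id

theorem contMDiff_inner_generator (m : RiemMetric E M) (hp : IsPrincipalFlowBundle E F g p) :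
    ContMDiff 𝓘(ℝ, E) 𝓘(ℝ, ℝ) ∞
      (fun x => m.inner x (generator E g x) (generator E g x)) := fun _ =>
  m.contMDiffAt_inner (b := fun x => x) hp.contMDiff_generator.contMDiffAt
    hp.contMDiff_generator.contMDiffAt

theorem exists_amendedPotential {m : RiemMetric E M} {V : M → ℝ}
    (hV : ContMDiff 𝓘(ℝ, E) 𝓘(ℝ, ℝ) ∞ V) (hp : IsPrincipalFlowBundle E F g p)
    (hgm : PreservesMetric m g) (hgV : ∀ τ x, V (g τ x) = V x) (k : ℝ) :
    ∃ V' : B → ℝ, (∀ x, V' (p x) =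
        V x + k ^ 2 / (2 * m.inner x (generator E g x) (generator E g x))) ∧
      ContMDiff 𝓘(ℝ, F) 𝓘(ℝ, ℝ) ∞ V' := by
  let W : M → ℝ := fun x => V x + k ^ 2 / (2 * m.inner x (generator E g x) (generator E g x))
  have hW : ContMDiff 𝓘(ℝ, E) 𝓘(ℝ, ℝ) ∞ W :=
    hV.add (contMDiff_const.div₀ (contMDiff_const.mul (contMDiff_inner_generator m hp))
      fun x => mul_ne_zero two_ne_zero (inner_generator_pos m hp x).ne')
  have hinv : ∀ x y, p x = p y → W x = W y := by
    intro x y hxy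
    obtain ⟨τ, rfl⟩ := (hp.fiber x y).1 hxy
    simp only [W, hgV, inner_generator_generator_flow hgm hp]
  have hV' : ∀ x, W (Function.surjInv hp.surjective (p x)) = W x := fun x =>
    hinv _ _ (Function.surjInv_eq hp.surjective (p x))
  refine ⟨fun b => W (Function.surjInv hp.surjective b), hV', fun b₀ => ?_⟩
  obtain ⟨U, s, hb, hs⟩ := hp.exists_flowSection b₀
  refine (hW.contMDiffAt.comp b₀ (hs.contMDiffAt hb)).congr_of_eventuallyEq ?_
  filter_upwards [hs.isOpen.mem_nhds hb] with b hb
  exact hinv _ _ ((Function.surjInv_eq hp.surjective b).trans (hs.proj_eq b hb).symm)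

/-- The energy is the energy of the reduced system up to a term that vanishes on the momentum
level. -/
theorem totalEnergy_eq_add [IsManifold 𝓘(ℝ, F) ∞ B] {m : RiemMetric E M} {V : M → ℝ}
    (hp : IsPrincipalFlowBundle E F g p) {m' : RiemMetric F B} {V' : B → ℝ} {k : ℝ}
    (hm' : ∀ (x : M) (w₁ w₂ : TangentSpace 𝓘(ℝ, E) x),
      m'.inner (p x) (mfderiv 𝓘(ℝ, E) 𝓘(ℝ, F) p x w₁) (mfderiv 𝓘(ℝ, E) 𝓘(ℝ, F) p x w₂) =
        transverseForm m g x w₁ w₂)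
    (hV' : ∀ x, V' (p x) = V x + k ^ 2 / (2 * m.inner x (generator E g x) (generator E g x)))
    (w : TangentBundle 𝓘(ℝ, E) M) :
    totalEnergy m V w = totalEnergy m' V' (tangentMap 𝓘(ℝ, E) 𝓘(ℝ, F) p w) +
      (momentum m g w ^ 2 - k ^ 2) *
        (2 * m.inner w.proj (generator E g w.proj) (generator E g w.proj))⁻¹ := by
  have h1 : kineticEnergy m' (tangentMap 𝓘(ℝ, E) 𝓘(ℝ, F) p w) =
      (1 / 2) * transverseForm m g w.proj w.2 w.2 := by rw [← hm']; rfl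
  have h2 : V' (tangentMap 𝓘(ℝ, E) 𝓘(ℝ, F) p w).proj = _ := hV' w.proj
  have h3 := (inner_generator_pos m hp w.proj).ne'
  rw [totalEnergy, totalEnergy, h1, h2, transverseForm_apply, kineticEnergy, momentum]
  field_simp
  ring

end Energy

/-! ### The connection form -/

section Connection

variable {E : Type*} [NormedAddCommGroup E] [NormedSpace ℝ E]
  {M : Type*} [TopologicalSpace M] [ChartedSpace E M] [IsManifold 𝓘(ℝ, E) ∞ M]
  {F : Type*} [NormedAddCommGroup F] [NormedSpace ℝ F]
  {B : Type*} [TopologicalSpace B] [ChartedSpace F B]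
  {g : ℝ → M → M} {p : M → B}

/-- The connection form `⟨v, ·⟩ / ⟨v, v⟩` whose horizontal spaces are the orthogonal complements
of the generating field `v`. -/
noncomputable def connectionForm (m : RiemMetric E M) (g : ℝ → M → M) : DiffForm 𝓘(ℝ, E) M 1 :=
  fun x => ContinuousAlternatingMap.ofSubsingleton ℝ (TangentSpace 𝓘(ℝ, E) x) ℝ (0 : Fin 1)
    ((m.inner x (generator E g x) (generator E g x))⁻¹ • m.inner x (generator E g x))

theorem connectionForm_apply (m : RiemMetric E M) (x : M) (u : Fin 1 → TangentSpace 𝓘(ℝ, E) x) :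
    connectionForm m g x u = (m.inner x (generator E g x) (generator E g x))⁻¹ *
      m.inner x (generator E g x) (u 0) := rfl

theorem isSmoothOneFormAt_connectionForm (m : RiemMetric E M) (hp : IsPrincipalFlowBundle E F g p)
    (x : M) : DiffForm.IsSmoothOneFormAt 𝓘(ℝ, E) (connectionForm m g) x := fun u =>
  (ContMDiffAt.comp (⟨x, u⟩ : TangentBundle 𝓘(ℝ, E) M)
    (g := fun x => (m.inner x (generator E g x) (generator E g x))⁻¹)
    ((contMDiff_inner_generator m hp).contMDiffAt.inv₀ (inner_generator_pos m hp x).ne')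
    contMDiff_proj_tangentBundle.contMDiffAt).mul (contMDiff_momentum m hp).contMDiffAt

/-- In terms of a flow section, the connection form is the differential of the flow time plus the
pullback of its restriction to the section. -/
theorem IsFlowSection.connectionForm_eq {U : Set B} {s : B → M} (hs : IsFlowSection E F g p U s)
    (hp : IsPrincipalFlowBundle E F g p) {m : RiemMetric E M} (hgm : PreservesMetric m g)
    {t : M → ℝ} {x : M}
    (ht : ∀ᶠ y in 𝓝 x, ContMDiffAt 𝓘(ℝ, E) 𝓘(ℝ, ℝ) ∞ t y ∧ p y ∈ U ∧
      g (t y) (s (p y)) = y) (Y : TangentSpace 𝓘(ℝ, E) x) :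
    connectionForm m g x (fun _ => Y) = diffAt 𝓘(ℝ, E) t x Y +
      connectionForm m g (s (p x)) (fun _ => mfderiv 𝓘(ℝ, E) 𝓘(ℝ, E) (s ∘ p) x Y) := by
  have h1 := hs.decomposition hp ht Y
  have hx := ht.self_of_nhds.2.2
  have h2 : connectionForm m g x (fun _ => Y) = connectionForm m g (g (t x) (s (p x)))
      (fun _ => diffAt 𝓘(ℝ, E) t x Y • generator E g (g (t x) (s (p x))) +
        mfderiv 𝓘(ℝ, E) 𝓘(ℝ, E) (g (t x)) (s (p x)) (mfderiv 𝓘(ℝ, E) 𝓘(ℝ, E) (s ∘ p) x Y)) := by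
    rw [← h1]
    exact DiffForm.apply_congr_point _ hx.symm _
  have h3 := (inner_generator_pos m hp (g (t x) (s (p x)))).ne'
  rw [h2, connectionForm_apply, connectionForm_apply, map_add, map_smul,
    inner_generator_flow hgm hp, ← inner_generator_generator_flow hgm hp (t x) (s (p x)),
    smul_eq_mul]
  field_simp

end Connection

/-! ### Decomposition of the Lagrange form -/

section ReducedForm

variable {E : Type*} [NormedAddCommGroup E] [NormedSpace ℝ E]
  {M : Type*} [TopologicalSpace M] [ChartedSpace E M] [IsManifold 𝓘(ℝ, E) ∞ M]
  {F : Type*} [NormedAddCommGroup F] [NormedSpace ℝ F]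
  {B : Type*} [TopologicalSpace B] [ChartedSpace F B] [IsManifold 𝓘(ℝ, F) ∞ B]
  {g : ℝ → M → M} {p : M → B}

/-- The constant `1`-form `k ds` on the real line. -/
noncomputable def lineForm (k : ℝ) : DiffForm 𝓘(ℝ, ℝ) ℝ 1 := fun x =>
  ContinuousAlternatingMap.ofSubsingleton ℝ (TangentSpace 𝓘(ℝ, ℝ) x) ℝ (0 : Fin 1)
    (k • ContinuousLinearMap.id ℝ ℝ)

theorem isSmoothOneFormAt_lineForm (k x : ℝ) :
    DiffForm.IsSmoothOneFormAt 𝓘(ℝ, ℝ) (lineForm k) x := fun _ =>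
  contMDiffAt_const.mul (contMDiff_snd_tangentBundle_modelSpace ℝ 𝓘(ℝ, ℝ)).contMDiffAt

/-- Alternating `2`-forms on the line vanish. -/
theorem d_lineForm (k x : ℝ) : DiffForm.d 𝓘(ℝ, ℝ) (lineForm k) x = 0 := by
  have key : ∀ (η : ℝ [⋀^Fin 2]→L[ℝ] ℝ), η = 0 := by
    intro η
    refine ContinuousAlternatingMap.ext fun v => ?_
    have h : v = fun i => v i • (1 : ℝ) := by funext i; simp
    rw [h]
    have h2 : η (fun i => v i • (1 : ℝ)) = _ := η.toMultilinearMap.map_smul_univ v (fun _ => 1)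
    rw [h2]
    have h3 : η.toMultilinearMap (fun _ => (1 : ℝ)) = 0 :=
      η.toAlternatingMap.map_eq_zero_of_eq (fun _ => (1 : ℝ)) (i := 0) (j := 1) rfl (by decide)
    rw [h3, smul_zero]
    rfl
  exact key _

/-- The `1`-form on the tangent bundle of the base whose differential represents the reduced form
over the domain of the section `s`: the Lagrange form of the reduced metric plus `k` times the
connection form restricted to the section (the potential of the magnetic term). -/
noncomputable def reducedOneForm (m : RiemMetric E M) (m' : RiemMetric F B) (g : ℝ → M → M)
    (k : ℝ) (s : B → M) : DiffForm 𝓘(ℝ, F).tangent (TangentBundle 𝓘(ℝ, F) B) 1 :=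
  lagrangeOneForm m' + DiffForm.pullback 𝓘(ℝ, F).tangent 𝓘(ℝ, E)
    (fun z : TangentBundle 𝓘(ℝ, F) B => s z.proj) (fun x => k • connectionForm m g x)

theorem IsFlowSection.isSmoothOneFormAt_reducedOneForm {U : Set B} {s : B → M}
    (hs : IsFlowSection E F g p U s) (hp : IsPrincipalFlowBundle E F g p) (m : RiemMetric E M)
    (m' : RiemMetric F B) (k : ℝ) {z : TangentBundle 𝓘(ℝ, F) B} (hz : z.proj ∈ U) :
    DiffForm.IsSmoothOneFormAt 𝓘(ℝ, F).tangent (reducedOneForm m m' g k s) z :=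
  (isSmoothOneFormAt_lagrangeOneForm m' z).add <|
    DiffForm.IsSmoothOneFormAt.pullback (f := fun z : TangentBundle 𝓘(ℝ, F) B => s z.proj)
      ((isSmoothOneFormAt_connectionForm m hp (s z.proj)).smul contMDiffAt_const)
      ((hs.contMDiffAt hz).comp z contMDiff_proj_tangentBundle.contMDiffAt)

/-- The derivative of `p_B ∘ Tp = p ∘ p_M`. -/
theorem mfderiv_proj_tangentMap (hp : IsPrincipalFlowBundle E F g p)
    (w : TangentBundle 𝓘(ℝ, E) M) (Y : TangentSpace 𝓘(ℝ, E).tangent w) :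
    (mfderiv 𝓘(ℝ, F).tangent 𝓘(ℝ, F) (fun z : TangentBundle 𝓘(ℝ, F) B => z.proj)
      (tangentMap 𝓘(ℝ, E) 𝓘(ℝ, F) p w)
      (mfderiv 𝓘(ℝ, E).tangent 𝓘(ℝ, F).tangent (tangentMap 𝓘(ℝ, E) 𝓘(ℝ, F) p) w Y) : F) =
    mfderiv 𝓘(ℝ, E) 𝓘(ℝ, F) p w.proj
      (mfderiv 𝓘(ℝ, E).tangent 𝓘(ℝ, E) (fun w : TangentBundle 𝓘(ℝ, E) M => w.proj) w Y) := by
  have h1 := mfderiv_comp w (g := fun z : TangentBundle 𝓘(ℝ, F) B => z.proj)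
    (contMDiff_proj_tangentBundle.contMDiffAt.mdifferentiableAt (by simp))
    ((ContMDiffAt.tangentMap_infty (w := w) hp.smooth_proj.contMDiffAt).mdifferentiableAt (by simp))
  have h2 := mfderiv_comp w (g := p) (f := fun w : TangentBundle 𝓘(ℝ, E) M => w.proj)
    (hp.mdifferentiableAt_proj w.proj)
    (contMDiff_proj_tangentBundle.contMDiffAt.mdifferentiableAt (by simp))
  exact congrArg (fun L : E × E →L[ℝ] F => L Y) (h1.symm.trans h2)

variable {m : RiemMetric E M} {m' : RiemMetric F B} {k : ℝ}

/-- Over a flow section, the Lagrange form is the pullback of `reducedOneForm` up to an exact form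
and a form that vanishes along the momentum level. -/
theorem IsFlowSection.lagrangeOneForm_eq {U : Set B} {s : B → M} (hs : IsFlowSection E F g p U s)
    (hp : IsPrincipalFlowBundle E F g p) (hgm : PreservesMetric m g)
    (hm' : ∀ (x : M) (w₁ w₂ : TangentSpace 𝓘(ℝ, E) x),
      m'.inner (p x) (mfderiv 𝓘(ℝ, E) 𝓘(ℝ, F) p x w₁) (mfderiv 𝓘(ℝ, E) 𝓘(ℝ, F) p x w₂) =
        transverseForm m g x w₁ w₂) {t : M → ℝ} {w : TangentBundle 𝓘(ℝ, E) M}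
    (ht : ∀ᶠ y in 𝓝 w.proj, ContMDiffAt 𝓘(ℝ, E) 𝓘(ℝ, ℝ) ∞ t y ∧ p y ∈ U ∧
      g (t y) (s (p y)) = y) :
    lagrangeOneForm m w =
      (DiffForm.pullback 𝓘(ℝ, E).tangent 𝓘(ℝ, F).tangent (tangentMap 𝓘(ℝ, E) 𝓘(ℝ, F) p)
          (reducedOneForm m m' g k s) +
        DiffForm.pullback 𝓘(ℝ, E).tangent 𝓘(ℝ, ℝ)
          (fun w : TangentBundle 𝓘(ℝ, E) M => t w.proj) (lineForm k) +
        fun w : TangentBundle 𝓘(ℝ, E) M => (momentum m g w - k) •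
          DiffForm.pullback 𝓘(ℝ, E).tangent 𝓘(ℝ, E)
            (fun w : TangentBundle 𝓘(ℝ, E) M => w.proj) (connectionForm m g) w) w := by
  refine ContinuousAlternatingMap.ext fun v => ?_
  obtain ⟨Y, rfl⟩ : ∃ Y, v = fun _ => Y := ⟨v 0, by funext i; rw [Subsingleton.elim i 0]⟩
  -- With `u = Tp_M Y`, all terms are evaluated on `u`; the identity is then the splitting of
  -- `⟨w, u⟩` into its transverse part and its part along `v`.
  obtain ⟨u, hu⟩ : ∃ u : TangentSpace 𝓘(ℝ, E) w.proj, mfderiv 𝓘(ℝ, E).tangent 𝓘(ℝ, E)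
      (fun w : TangentBundle 𝓘(ℝ, E) M => w.proj) w Y = u := ⟨_, rfl⟩
  have hx := ht.self_of_nhds
  have hπ : MDifferentiableAt 𝓘(ℝ, E).tangent 𝓘(ℝ, E)
      (fun w : TangentBundle 𝓘(ℝ, E) M => w.proj) w :=
    contMDiff_proj_tangentBundle.contMDiffAt.mdifferentiableAt (by simp)
  have hρ : MDifferentiableAt 𝓘(ℝ, E).tangent 𝓘(ℝ, F).tangent (tangentMap 𝓘(ℝ, E) 𝓘(ℝ, F) p) w :=
    (ContMDiffAt.tangentMap_infty (w := w) hp.smooth_proj.contMDiffAt).mdifferentiableAt (by simp)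
  have e0 : lagrangeOneForm m w (fun _ => Y) = m.inner w.proj w.2 u := by
    rw [lagrangeOneForm_apply]
    exact congrArg (m.inner w.proj w.2) hu
  have e1 : DiffForm.pullback 𝓘(ℝ, E).tangent 𝓘(ℝ, F).tangent (tangentMap 𝓘(ℝ, E) 𝓘(ℝ, F) p)
      (lagrangeOneForm m') w (fun _ => Y) = transverseForm m g w.proj w.2 u := by
    rw [← hm', DiffForm.pullback_apply, lagrangeOneForm_apply]
    refine congrArg (m'.inner (p w.proj) (mfderiv 𝓘(ℝ, E) 𝓘(ℝ, F) p w.proj w.2)) ?_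
    exact (mfderiv_proj_tangentMap hp w Y).trans (congrArg _ hu)
  have e2 : DiffForm.pullback 𝓘(ℝ, E).tangent 𝓘(ℝ, F).tangent (tangentMap 𝓘(ℝ, E) 𝓘(ℝ, F) p)
      (DiffForm.pullback 𝓘(ℝ, F).tangent 𝓘(ℝ, E)
        (fun z : TangentBundle 𝓘(ℝ, F) B => s z.proj) (fun x => k • connectionForm m g x)) w
      (fun _ => Y) = k * connectionForm m g (s (p w.proj))
        (fun _ => mfderiv 𝓘(ℝ, E) 𝓘(ℝ, E) (s ∘ p) w.proj u) := by
    have h1 := DiffForm.pullback_comp (I := 𝓘(ℝ, E).tangent) (I' := 𝓘(ℝ, F).tangent)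
      (I'' := 𝓘(ℝ, E)) (fun x => k • connectionForm m g x)
      (g := fun z : TangentBundle 𝓘(ℝ, F) B => s z.proj) (x := w)
      ((hs.mdifferentiableAt hx.2.1).comp (tangentMap 𝓘(ℝ, E) 𝓘(ℝ, F) p w)
        (contMDiff_proj_tangentBundle.contMDiffAt.mdifferentiableAt (by simp))) hρ
    have h2 := mfderiv_comp w (g := s ∘ p) (f := fun w : TangentBundle 𝓘(ℝ, E) M => w.proj)
      ((hs.mdifferentiableAt hx.2.1).comp w.proj (hp.mdifferentiableAt_proj w.proj)) hπ
    rw [← h1, DiffForm.pullback_apply]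
    refine congrArg (fun e : E => k * connectionForm m g (s (p w.proj)) (fun _ => e)) ?_
    refine (congrArg (fun L : E × E →L[ℝ] E => L Y) h2).trans ?_
    exact congrArg (mfderiv 𝓘(ℝ, E) 𝓘(ℝ, E) (s ∘ p) w.proj) hu
  have e3 : DiffForm.pullback 𝓘(ℝ, E).tangent 𝓘(ℝ, ℝ)
      (fun w : TangentBundle 𝓘(ℝ, E) M => t w.proj) (lineForm k) w (fun _ => Y) =
      k * diffAt 𝓘(ℝ, E) t w.proj u := by
    have h2 := mfderiv_comp w (g := t) (f := fun w : TangentBundle 𝓘(ℝ, E) M => w.proj)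
      (hx.1.mdifferentiableAt (by simp)) hπ
    rw [DiffForm.pullback_apply]
    refine congrArg (fun e : ℝ => k * e) ?_
    refine (congrArg (fun L : E × E →L[ℝ] ℝ => L Y) h2).trans ?_
    exact congrArg (mfderiv 𝓘(ℝ, E) 𝓘(ℝ, ℝ) t w.proj) hu
  have e4 : DiffForm.pullback 𝓘(ℝ, E).tangent 𝓘(ℝ, E)
      (fun w : TangentBundle 𝓘(ℝ, E) M => w.proj) (connectionForm m g) w (fun _ => Y) =
      connectionForm m g w.proj (fun _ => u) := by
    rw [DiffForm.pullback_apply]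
    exact congrArg (fun e : E => connectionForm m g w.proj (fun _ => e)) hu
  have e5 := hs.connectionForm_eq hp hgm ht u
  have e6 : lagrangeOneForm m w (fun _ => Y) = transverseForm m g w.proj w.2 u +
      k * connectionForm m g (s (p w.proj))
        (fun _ => mfderiv 𝓘(ℝ, E) 𝓘(ℝ, E) (s ∘ p) w.proj u) + k * diffAt 𝓘(ℝ, E) t w.proj u +
      (momentum m g w - k) * connectionForm m g w.proj (fun _ => u) := by
    rw [e0, transverseForm_apply]
    have : m.inner w.proj w.2 u = (m.inner w.proj w.2 u -
      (m.inner w.proj (generator E g w.proj) (generator E g w.proj))⁻¹ *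
        (m.inner w.proj (generator E g w.proj) w.2 * m.inner w.proj (generator E g w.proj) u)) +
        momentum m g w * connectionForm m g w.proj (fun _ => u) := by
      rw [connectionForm_apply, momentum]; ring
    linear_combination this + k * e5
  rw [e6, ← e1, ← e2, ← e3, ← e4]
  rfl

end ReducedForm

theorem DiffForm.pullback_apply_two {E : Type*} [NormedAddCommGroup E] [NormedSpace ℝ E]
    {H : Type*} [TopologicalSpace H] {I : ModelWithCorners ℝ E H}
    {E' : Type*} [NormedAddCommGroup E'] [NormedSpace ℝ E']
    {H' : Type*} [TopologicalSpace H'] {I' : ModelWithCorners ℝ E' H'}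
    {N : Type*} [TopologicalSpace N] [ChartedSpace H N]
    {N' : Type*} [TopologicalSpace N'] [ChartedSpace H' N'] (f : N → N') (α : DiffForm I' N' 2)
    (x : N) (u v : TangentSpace I x) :
    pullback I I' f α x ![u, v] = α (f x) ![mfderiv I I' f x u, mfderiv I I' f x v] := by
  refine congrArg (α (f x)) (funext fun i => ?_)
  fin_cases i <;> rfl

/-! ### Linear algebra of the reduction -/

section LinearReduction

variable {W W' : Type*} [AddCommGroup W] [Module ℝ W] [FiniteDimensional ℝ W]
  [AddCommGroup W'] [Module ℝ W'] [FiniteDimensional ℝ W']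

/-- Linear algebra of the reduction: if a nondegenerate form on `W` is `L^* τ + j ∧ a` and `L` maps
to a space `W'` of codimension two, then `(L, j)` is onto, `a` does not vanish on its kernel, and
`τ` is nondegenerate. -/
theorem linear_reduction (hdim : Module.finrank ℝ W = Module.finrank ℝ W' + 2)
    (L : W →ₗ[ℝ] W') (j a : W →ₗ[ℝ] ℝ) {σ : W → W → ℝ} {τ : W' → W' → ℝ}
    (hσ : ∀ u, (∀ v, σ u v = 0) → u = 0) (hτ : ∀ v, τ 0 v = 0)
    (h : ∀ u v, σ u v = τ (L u) (L v) + (j u * a v - j v * a u)) :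
    (∀ z c, ∃ u, L u = z ∧ j u = c) ∧ (∃ u, L u = 0 ∧ j u = 0 ∧ a u ≠ 0) ∧
      ∀ z, (∀ v, τ z v = 0) → z = 0 := by
  have hinj : ∀ u, L u = 0 → j u = 0 → a u = 0 → u = 0 := fun u h₁ h₂ h₃ => hσ u fun v => by
    rw [h, h₁, h₂, h₃, hτ]; ring
  set K := LinearMap.ker (L.prod j) with hK
  -- `a` is injective on `K`, which bounds the dimension of `K` by one.
  have hKle : Module.finrank ℝ K ≤ 1 := by
    have := LinearMap.finrank_le_finrank_of_injective (f := a.domRestrict K) (by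
      rw [injective_iff_map_eq_zero]
      rintro ⟨u, hu⟩ h0
      have hu' : (L u, j u) = (0, 0) := hu
      exact Subtype.ext (hinj u (congrArg Prod.fst hu') (congrArg Prod.snd hu') h0))
    simpa using this
  have hrn := (L.prod j).finrank_range_add_finrank_ker
  rw [← hK] at hrn
  have hcod : Module.finrank ℝ (W' × ℝ) = Module.finrank ℝ W' + 1 := by simp
  have hrange : LinearMap.range (L.prod j) = ⊤ := by
    apply Submodule.eq_top_of_finrank_eq
    have := Submodule.finrank_le (LinearMap.range (L.prod j))
    omega
  have hsurj : ∀ z c, ∃ u, L u = z ∧ j u = c := fun z c => by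
    obtain ⟨u, hu⟩ := LinearMap.range_eq_top.1 hrange (z, c)
    exact ⟨u, congrArg Prod.fst hu, congrArg Prod.snd hu⟩
  have hker : ∃ u, L u = 0 ∧ j u = 0 ∧ a u ≠ 0 := by
    have h1 : Module.finrank ℝ (LinearMap.range (L.prod j)) = Module.finrank ℝ W' + 1 := by
      rw [hrange, finrank_top, hcod]
    have h2 : K ≠ ⊥ := fun h0 => by
      rw [h0, finrank_bot] at hrn
      omega
    obtain ⟨u, hu, hu0⟩ := Submodule.exists_mem_ne_zero_of_ne_bot h2
    have hu' : (L u, j u) = (0, 0) := hu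
    exact ⟨u, congrArg Prod.fst hu', congrArg Prod.snd hu', fun ha =>
      hu0 (hinj u (congrArg Prod.fst hu') (congrArg Prod.snd hu') ha)⟩
  refine ⟨hsurj, hker, fun z hz => ?_⟩
  -- A lift of `z` in the kernel of `j`, corrected by a multiple of `ξ` so that `a` vanishes on it,
  -- lies in the radical of `σ`.
  obtain ⟨u, rfl, hu⟩ := hsurj z 0
  obtain ⟨ξ, h₁, h₂, h₃⟩ := hker
  have h0 : u - (a u / a ξ) • ξ = 0 := hσ _ fun v => by
    rw [h]
    simp only [map_sub, map_smul, h₁, h₂, hu, smul_zero, sub_zero, hz, smul_eq_mul,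
      div_mul_cancel₀ _ h₃, sub_self, mul_zero, zero_mul, add_zero]
  rw [sub_eq_zero.1 h0, map_smul, h₁, smul_zero]

end LinearReduction

section ReducedForm

variable {E : Type*} [NormedAddCommGroup E] [NormedSpace ℝ E] [FiniteDimensional ℝ E]
  {M : Type*} [TopologicalSpace M] [ChartedSpace E M] [IsManifold 𝓘(ℝ, E) ∞ M]
  {F : Type*} [NormedAddCommGroup F] [NormedSpace ℝ F] [FiniteDimensional ℝ F]
  {B : Type*} [TopologicalSpace B] [ChartedSpace F B] [IsManifold 𝓘(ℝ, F) ∞ B]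
  {g : ℝ → M → M} {p : M → B} {m : RiemMetric E M} {m' : RiemMetric F B} {k : ℝ}

/-- On the momentum level, the Lagrange `2`-form is the pullback of the differential of
`reducedOneForm` up to the wedge product of the differential of the momentum and the connection
form. -/
theorem IsFlowSection.lagrangeTwoForm_eq {U : Set B} {s : B → M} (hs : IsFlowSection E F g p U s)
    (hp : IsPrincipalFlowBundle E F g p) (hgm : PreservesMetric m g)
    (hm' : ∀ (x : M) (w₁ w₂ : TangentSpace 𝓘(ℝ, E) x),
      m'.inner (p x) (mfderiv 𝓘(ℝ, E) 𝓘(ℝ, F) p x w₁) (mfderiv 𝓘(ℝ, E) 𝓘(ℝ, F) p x w₂) =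
        transverseForm m g x w₁ w₂) {w : TangentBundle 𝓘(ℝ, E) M} (hw : w ∈ momentumLevel m g k)
    (hwU : p w.proj ∈ U) (Y₁ Y₂ : TangentSpace 𝓘(ℝ, E).tangent w) :
    lagrangeTwoForm m w ![Y₁, Y₂] =
      DiffForm.d 𝓘(ℝ, F).tangent (reducedOneForm m m' g k s) (tangentMap 𝓘(ℝ, E) 𝓘(ℝ, F) p w)
        ![mfderiv 𝓘(ℝ, E).tangent 𝓘(ℝ, F).tangent (tangentMap 𝓘(ℝ, E) 𝓘(ℝ, F) p) w Y₁,
          mfderiv 𝓘(ℝ, E).tangent 𝓘(ℝ, F).tangent (tangentMap 𝓘(ℝ, E) 𝓘(ℝ, F) p) w Y₂] +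
      (diffAt 𝓘(ℝ, E).tangent (momentum m g) w Y₁ *
          DiffForm.pullback 𝓘(ℝ, E).tangent 𝓘(ℝ, E)
            (fun w : TangentBundle 𝓘(ℝ, E) M => w.proj) (connectionForm m g) w (fun _ => Y₂) -
        diffAt 𝓘(ℝ, E).tangent (momentum m g) w Y₂ *
          DiffForm.pullback 𝓘(ℝ, E).tangent 𝓘(ℝ, E)
            (fun w : TangentBundle 𝓘(ℝ, E) M => w.proj) (connectionForm m g) w (fun _ => Y₁)) := by
  obtain ⟨t, ht⟩ := hs.exists_time hp hwU
  have hπ : ContMDiffAt 𝓘(ℝ, E).tangent 𝓘(ℝ, E) ∞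
      (fun w : TangentBundle 𝓘(ℝ, E) M => w.proj) w := contMDiff_proj_tangentBundle.contMDiffAt
  have hev := hπ.continuousAt.eventually ht.eventually_nhds
  have hρ : ContMDiffAt 𝓘(ℝ, E).tangent 𝓘(ℝ, F).tangent ∞ (tangentMap 𝓘(ℝ, E) 𝓘(ℝ, F) p) w :=
    ContMDiffAt.tangentMap_infty (w := w) hp.smooth_proj.contMDiffAt
  have htπ : ContMDiffAt 𝓘(ℝ, E).tangent 𝓘(ℝ, ℝ) ∞
      (fun w : TangentBundle 𝓘(ℝ, E) M => t w.proj) w :=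
    ContMDiffAt.comp w (g := t) ht.self_of_nhds.1 hπ
  have hJ : ContMDiffAt 𝓘(ℝ, E).tangent 𝓘(ℝ, ℝ) ∞ (fun w => momentum m g w - k) w :=
    (contMDiff_momentum m hp).contMDiffAt.sub contMDiffAt_const
  have s1 := hs.isSmoothOneFormAt_reducedOneForm hp m m' k
    (z := tangentMap 𝓘(ℝ, E) 𝓘(ℝ, F) p w) hwU
  have s2 := isSmoothOneFormAt_lineForm k (t w.proj)
  have s2' := DiffForm.IsSmoothOneFormAt.pullback
    (f := fun w : TangentBundle 𝓘(ℝ, E) M => t w.proj) s2 htπ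
  have s3 := (isSmoothOneFormAt_connectionForm m hp w.proj).pullback hπ
  have h1 := DiffForm.d_congr (I := 𝓘(ℝ, E).tangent)
    (hev.mono fun w' hw' => hs.lagrangeOneForm_eq hp hgm hm' (k := k) hw')
  rw [DiffForm.d_add ((s1.pullback hρ).add s2').differentiableAt_inChart
      (s3.smul hJ).differentiableAt_inChart,
    DiffForm.d_add (s1.pullback hρ).differentiableAt_inChart
      s2'.differentiableAt_inChart,
    DiffForm.d_pullback hρ s1.differentiableAt_inChart,
    DiffForm.d_pullback htπ s2.differentiableAt_inChart] at h1
  have h2 := DiffForm.d_smul_apply_of_eq_zero hJ (sub_eq_zero.2 hw) s3.differentiableAt_inChart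
    Y₁ Y₂
  have h3 : diffAt 𝓘(ℝ, E).tangent (fun w => momentum m g w - k) w =
      diffAt 𝓘(ℝ, E).tangent (momentum m g) w := by
    have := mfderiv_sub (I := 𝓘(ℝ, E).tangent) (z := w) (g := fun _ => k)
      ((contMDiff_momentum m hp).contMDiffAt.mdifferentiableAt (by simp)) mdifferentiableAt_const
    refine this.trans ?_
    rw [mfderiv_const]
    exact sub_zero _
  have h4 := congrArg (fun η : (E × E) [⋀^Fin 2]→L[ℝ] ℝ => η ![Y₁, Y₂]) h1
  refine h4.trans ?_
  rw [h3] at h2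
  rw [← h2]
  have h5 : ∀ v, DiffForm.pullback 𝓘(ℝ, E).tangent 𝓘(ℝ, ℝ)
      (fun w : TangentBundle 𝓘(ℝ, E) M => t w.proj) (DiffForm.d 𝓘(ℝ, ℝ) (lineForm k)) w v = 0 := by
    intro v
    rw [DiffForm.pullback_apply, d_lineForm]
    rfl
  have h6 := h5 ![Y₁, Y₂]
  have h7 : ∀ a b c : (E × E) [⋀^Fin 2]→L[ℝ] ℝ, b ![Y₁, Y₂] = 0 →
      (a + b + c) ![Y₁, Y₂] = a ![Y₁, Y₂] + c ![Y₁, Y₂] := by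
    intro a b c hb
    change a ![Y₁, Y₂] + b ![Y₁, Y₂] + c ![Y₁, Y₂] = _
    rw [hb, add_zero]
  refine (h7 _ _ _ h6).trans ?_
  congr 1
  exact DiffForm.pullback_apply_two _ _ _ Y₁ Y₂

end ReducedForm

/-! ### The reduced form -/

section ReducedForm

variable {E : Type*} [NormedAddCommGroup E] [NormedSpace ℝ E] [FiniteDimensional ℝ E]
  {M : Type*} [TopologicalSpace M] [ChartedSpace E M] [IsManifold 𝓘(ℝ, E) ∞ M]
  {F : Type*} [NormedAddCommGroup F] [NormedSpace ℝ F] [FiniteDimensional ℝ F]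
  {B : Type*} [TopologicalSpace B] [ChartedSpace F B] [IsManifold 𝓘(ℝ, F) ∞ B]
  {g : ℝ → M → M} {p : M → B} {m : RiemMetric E M} {m' : RiemMetric F B} {k : ℝ}

omit [FiniteDimensional ℝ E] [FiniteDimensional ℝ F] [IsManifold 𝓘(ℝ, F) ∞ B] in
theorem IsPrincipalFlowBundle.exists_mem_momentumLevel (hp : IsPrincipalFlowBundle E F g p)
    (m : RiemMetric E M) (k : ℝ) (z : TangentBundle 𝓘(ℝ, F) B) :
    ∃ w ∈ momentumLevel m g k, tangentMap 𝓘(ℝ, E) 𝓘(ℝ, F) p w = z := by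
  obtain ⟨b, f⟩ := z
  obtain ⟨x, rfl⟩ := hp.surjective b
  obtain ⟨u, rfl, hu⟩ := hp.exists_horizontal m x f k
  exact ⟨⟨x, u⟩, hu, rfl⟩

/-- The Lagrange `2`-form at `w` is the pullback of `η` under `T(Tp)` plus the wedge product of
the differential of the momentum and the linear form `a`. In particular `η` represents the
restriction of the Lagrange form to the momentum level through `w`. -/
def IsReductionAt (m : RiemMetric E M) (g : ℝ → M → M) (p : M → B)
    (w : TangentBundle 𝓘(ℝ, E) M)
    (η : TangentSpace 𝓘(ℝ, F).tangent (tangentMap 𝓘(ℝ, E) 𝓘(ℝ, F) p w) [⋀^Fin 2]→L[ℝ] ℝ)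
    (a : E × E →ₗ[ℝ] ℝ) : Prop :=
  ∀ Y₁ Y₂ : TangentSpace 𝓘(ℝ, E).tangent w, lagrangeTwoForm m w ![Y₁, Y₂] =
    η ![mfderiv 𝓘(ℝ, E).tangent 𝓘(ℝ, F).tangent (tangentMap 𝓘(ℝ, E) 𝓘(ℝ, F) p) w Y₁,
        mfderiv 𝓘(ℝ, E).tangent 𝓘(ℝ, F).tangent (tangentMap 𝓘(ℝ, E) 𝓘(ℝ, F) p) w Y₂] +
      (diffAt 𝓘(ℝ, E).tangent (momentum m g) w Y₁ * a Y₂ -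
        diffAt 𝓘(ℝ, E).tangent (momentum m g) w Y₂ * a Y₁)

/-- `linear_reduction` for the derivatives at `w` of `Tp` and of the momentum. -/
theorem IsPrincipalFlowBundle.linear_reduction (hp : IsPrincipalFlowBundle E F g p)
    (w : TangentBundle 𝓘(ℝ, E) M)
    (η : TangentSpace 𝓘(ℝ, F).tangent (tangentMap 𝓘(ℝ, E) 𝓘(ℝ, F) p w) [⋀^Fin 2]→L[ℝ] ℝ)
    (a : E × E →ₗ[ℝ] ℝ)
    (h : IsReductionAt m g p w η a) :
    (∀ (z : TangentSpace 𝓘(ℝ, F).tangent (tangentMap 𝓘(ℝ, E) 𝓘(ℝ, F) p w)) (c : ℝ),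
      ∃ Y : TangentSpace 𝓘(ℝ, E).tangent w,
        mfderiv 𝓘(ℝ, E).tangent 𝓘(ℝ, F).tangent (tangentMap 𝓘(ℝ, E) 𝓘(ℝ, F) p) w Y = z ∧
        diffAt 𝓘(ℝ, E).tangent (momentum m g) w Y = c) ∧
    (∃ Y : TangentSpace 𝓘(ℝ, E).tangent w,
      mfderiv 𝓘(ℝ, E).tangent 𝓘(ℝ, F).tangent (tangentMap 𝓘(ℝ, E) 𝓘(ℝ, F) p) w Y = 0 ∧
      diffAt 𝓘(ℝ, E).tangent (momentum m g) w Y = 0 ∧ a Y ≠ 0) ∧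
    ∀ z : TangentSpace 𝓘(ℝ, F).tangent (tangentMap 𝓘(ℝ, E) 𝓘(ℝ, F) p w),
      (∀ z', η ![z, z'] = 0) → z = 0 := by
  let L : E × E →L[ℝ] F × F :=
    mfderiv 𝓘(ℝ, E).tangent 𝓘(ℝ, F).tangent (tangentMap 𝓘(ℝ, E) 𝓘(ℝ, F) p) w
  let j : E × E →L[ℝ] ℝ := diffAt 𝓘(ℝ, E).tangent (momentum m g) w
  let η' : (F × F) [⋀^Fin 2]→L[ℝ] ℝ := η
  let σ' : (E × E) [⋀^Fin 2]→L[ℝ] ℝ := lagrangeTwoForm m w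
  have hdim : Module.finrank ℝ (E × E) = Module.finrank ℝ (F × F) + 2 := by
    have := hp.finrank_eq (p w.proj)
    simp only [Module.finrank_prod]
    omega
  exact _root_.linear_reduction hdim (L : E × E →ₗ[ℝ] F × F) (j : E × E →ₗ[ℝ] ℝ) a
    (σ := fun u v => σ' ![u, v]) (τ := fun u v => η' ![u, v])
    (fun u hu => lagrangeTwoForm_nondegenerate m w u hu)
    (fun v => η'.map_coord_zero (0 : Fin 2) rfl) h

omit [FiniteDimensional ℝ E] [FiniteDimensional ℝ F] in
/-- The pullback of the connection form to the tangent bundle, as a linear form. -/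
theorem exists_linear_eq_pullback_connectionForm (m : RiemMetric E M) (g : ℝ → M → M)
    (w : TangentBundle 𝓘(ℝ, E) M) : ∃ a : E × E →ₗ[ℝ] ℝ,
      ∀ Y : TangentSpace 𝓘(ℝ, E).tangent w, DiffForm.pullback 𝓘(ℝ, E).tangent 𝓘(ℝ, E)
        (fun w : TangentBundle 𝓘(ℝ, E) M => w.proj) (connectionForm m g) w (fun _ => Y) = a Y := by
  let L : E × E →L[ℝ] E := mfderiv 𝓘(ℝ, E).tangent 𝓘(ℝ, E)
    (fun w : TangentBundle 𝓘(ℝ, E) M => w.proj) w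
  let c : E →L[ℝ] ℝ := (m.inner w.proj (generator E g w.proj) (generator E g w.proj))⁻¹ •
    m.inner w.proj (generator E g w.proj)
  exact ⟨(c.comp L : E × E →L[ℝ] ℝ), fun _ => rfl⟩

/-- The reduced form: locally the differential of `reducedOneForm`. -/
theorem exists_reducedForm (hp : IsPrincipalFlowBundle E F g p) (hgm : PreservesMetric m g)
    (hm' : ∀ (x : M) (w₁ w₂ : TangentSpace 𝓘(ℝ, E) x),
      m'.inner (p x) (mfderiv 𝓘(ℝ, E) 𝓘(ℝ, F) p x w₁) (mfderiv 𝓘(ℝ, E) 𝓘(ℝ, F) p x w₂) =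
        transverseForm m g x w₁ w₂) (k : ℝ) :
    ∃ σ' : DiffForm 𝓘(ℝ, F).tangent (TangentBundle 𝓘(ℝ, F) B) 2,
      DiffForm.IsSymplectic 𝓘(ℝ, F).tangent σ' ∧
      ∀ w ∈ momentumLevel m g k, ∃ a : E × E →ₗ[ℝ] ℝ,
        IsReductionAt m g p w (σ' (tangentMap 𝓘(ℝ, E) 𝓘(ℝ, F) p w)) a := by
  choose U s hbU hs using hp.exists_flowSection
  let σ' : DiffForm 𝓘(ℝ, F).tangent (TangentBundle 𝓘(ℝ, F) B) 2 := fun z =>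
    DiffForm.d 𝓘(ℝ, F).tangent (reducedOneForm m m' g k (s z.proj)) z
  have hloc : ∀ w ∈ momentumLevel m g k, ∃ a : E × E →ₗ[ℝ] ℝ, ∀ (U : Set B) (s : B → M),
      IsFlowSection E F g p U s → p w.proj ∈ U →
      IsReductionAt m g p w (DiffForm.d 𝓘(ℝ, F).tangent (reducedOneForm m m' g k s)
        (tangentMap 𝓘(ℝ, E) 𝓘(ℝ, F) p w)) a := by
    intro w hw
    obtain ⟨a, ha⟩ := exists_linear_eq_pullback_connectionForm m g w
    refine ⟨a, fun U s hs hwU Y₁ Y₂ => ?_⟩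
    rw [← ha, ← ha]
    exact hs.lagrangeTwoForm_eq hp hgm hm' hw hwU Y₁ Y₂
  -- The differential of `reducedOneForm` does not depend on the section, since it is determined by
  -- the Lagrange form on the momentum level.
  have hσ : ∀ (z : TangentBundle 𝓘(ℝ, F) B) (U : Set B) (s : B → M),
      IsFlowSection E F g p U s → z.proj ∈ U →
      σ' z = DiffForm.d 𝓘(ℝ, F).tangent (reducedOneForm m m' g k s) z := by
    intro z U₁ s₁ hs₁ hz
    obtain ⟨w, hw, rfl⟩ := hp.exists_mem_momentumLevel m k z
    obtain ⟨a, ha⟩ := hloc w hw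
    have h2 := ha _ _ (hs (p w.proj)) (hbU (p w.proj))
    have hr := (hp.linear_reduction w _ a h2).1
    refine ContinuousAlternatingMap.ext fun v => ?_
    obtain ⟨Y₁, hY₁, hj₁⟩ := hr (v 0) 0
    obtain ⟨Y₂, hY₂, hj₂⟩ := hr (v 1) 0
    have hv : v = ![mfderiv 𝓘(ℝ, E).tangent 𝓘(ℝ, F).tangent (tangentMap 𝓘(ℝ, E) 𝓘(ℝ, F) p) w Y₁,
        mfderiv 𝓘(ℝ, E).tangent 𝓘(ℝ, F).tangent (tangentMap 𝓘(ℝ, E) 𝓘(ℝ, F) p) w Y₂] := by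
      rw [hY₁, hY₂]
      funext i
      fin_cases i <;> rfl
    rw [hv]
    have h3 := (h2 Y₁ Y₂).symm.trans (ha _ _ hs₁ hz Y₁ Y₂)
    exact add_right_cancel h3
  have hform : ∀ w ∈ momentumLevel m g k, ∃ a : E × E →ₗ[ℝ] ℝ,
      IsReductionAt m g p w (σ' (tangentMap 𝓘(ℝ, E) 𝓘(ℝ, F) p w)) a := by
    intro w hw
    obtain ⟨a, ha⟩ := hloc w hw
    exact ⟨a, ha _ _ (hs (p w.proj)) (hbU (p w.proj))⟩
  have hsc := DiffForm.isSmooth_and_closed_of_locally_exact (I := 𝓘(ℝ, F).tangent) (η := σ')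
    fun z => ⟨reducedOneForm m m' g k (s z.proj), by
      have hev : ∀ᶠ z' : TangentBundle 𝓘(ℝ, F) B in 𝓝 z, z'.proj ∈ U z.proj :=
        (contMDiff_proj_tangentBundle (M := B)).continuous.continuousAt.eventually
          ((hs z.proj).isOpen.mem_nhds (hbU z.proj))
      filter_upwards [hev] with z' hz'
      exact ⟨(hs z.proj).isSmoothOneFormAt_reducedOneForm hp m m' k hz',
        hσ z' _ _ (hs z.proj) hz'⟩⟩
  refine ⟨σ', ⟨hsc.1, hsc.2, fun z u hu => ?_⟩, hform⟩
  obtain ⟨w, hw, rfl⟩ := hp.exists_mem_momentumLevel m k z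
  obtain ⟨a, ha⟩ := hform w hw
  exact (hp.linear_reduction w _ a ha).2.2 u hu

end ReducedForm

/-! ### The reduced system -/

section ReducedSystem

variable {E : Type*} [NormedAddCommGroup E] [NormedSpace ℝ E] [FiniteDimensional ℝ E]
  {M : Type*} [TopologicalSpace M] [ChartedSpace E M] [IsManifold 𝓘(ℝ, E) ∞ M]
  {F : Type*} [NormedAddCommGroup F] [NormedSpace ℝ F] [FiniteDimensional ℝ F]
  {B : Type*} [TopologicalSpace B] [ChartedSpace F B] [IsManifold 𝓘(ℝ, F) ∞ B]
  {g : ℝ → M → M} {p : M → B} {m : RiemMetric E M} {m' : RiemMetric F B} {k : ℝ}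

theorem isReducedForm_iff (hp : IsPrincipalFlowBundle E F g p)
    {σ' : DiffForm 𝓘(ℝ, F).tangent (TangentBundle 𝓘(ℝ, F) B) 2}
    (hσ' : ∀ w ∈ momentumLevel m g k, ∃ a : E × E →ₗ[ℝ] ℝ,
      IsReductionAt m g p w (σ' (tangentMap 𝓘(ℝ, E) 𝓘(ℝ, F) p w)) a)
    (α : DiffForm 𝓘(ℝ, F).tangent (TangentBundle 𝓘(ℝ, F) B) 2) :
    IsReducedForm m g p k α ↔ α = σ' := by
  have h0 : IsReducedForm m g p k σ' := by
    intro w hw Y₁ h₁ Y₂ h₂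
    obtain ⟨a, ha⟩ := hσ' w hw
    have h₁' : diffAt 𝓘(ℝ, E).tangent (momentum m g) w Y₁ = 0 := h₁
    have h₂' : diffAt 𝓘(ℝ, E).tangent (momentum m g) w Y₂ = 0 := h₂
    rw [DiffForm.pullback_apply_two, ha, h₁', h₂']
    ring
  refine ⟨fun hα => funext fun z => ?_, fun h => h ▸ h0⟩
  obtain ⟨w, hw, rfl⟩ := hp.exists_mem_momentumLevel m k z
  obtain ⟨a, ha⟩ := hσ' w hw
  have hr := (hp.linear_reduction w _ a ha).1
  refine ContinuousAlternatingMap.ext fun v => ?_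
  obtain ⟨Y₁, hY₁, hj₁⟩ := hr (v 0) 0
  obtain ⟨Y₂, hY₂, hj₂⟩ := hr (v 1) 0
  have hv : v = ![mfderiv 𝓘(ℝ, E).tangent 𝓘(ℝ, F).tangent (tangentMap 𝓘(ℝ, E) 𝓘(ℝ, F) p) w Y₁,
      mfderiv 𝓘(ℝ, E).tangent 𝓘(ℝ, F).tangent (tangentMap 𝓘(ℝ, E) 𝓘(ℝ, F) p) w Y₂] := by
    rw [hY₁, hY₂]
    funext i
    fin_cases i <;> rfl
  rw [hv, ← DiffForm.pullback_apply_two, ← DiffForm.pullback_apply_two,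
    hα w hw Y₁ hj₁ Y₂ hj₂, h0 w hw Y₁ hj₁ Y₂ hj₂]

omit [FiniteDimensional ℝ E] [FiniteDimensional ℝ F] in
/-- On a momentum level, the differential of the energy is the pullback of the differential of the
reduced energy up to a multiple of the differential of the momentum. -/
theorem diffAt_totalEnergy (hp : IsPrincipalFlowBundle E F g p) {V : M → ℝ} {V' : B → ℝ}
    (hm' : ∀ (x : M) (w₁ w₂ : TangentSpace 𝓘(ℝ, E) x),
      m'.inner (p x) (mfderiv 𝓘(ℝ, E) 𝓘(ℝ, F) p x w₁) (mfderiv 𝓘(ℝ, E) 𝓘(ℝ, F) p x w₂) =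
        transverseForm m g x w₁ w₂)
    (hV' : ∀ x, V' (p x) = V x + k ^ 2 / (2 * m.inner x (generator E g x) (generator E g x)))
    (hV's : ContMDiff 𝓘(ℝ, F) 𝓘(ℝ, ℝ) ∞ V')
    {w : TangentBundle 𝓘(ℝ, E) M} (hw : w ∈ momentumLevel m g k)
    {Y : TangentSpace 𝓘(ℝ, E).tangent w} (hY : Y ∈ levelTangentSpace m g w) :
    diffAt 𝓘(ℝ, E).tangent (totalEnergy m V) w Y =
      diffAt 𝓘(ℝ, F).tangent (totalEnergy m' V') (tangentMap 𝓘(ℝ, E) 𝓘(ℝ, F) p w)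
        (mfderiv 𝓘(ℝ, E).tangent 𝓘(ℝ, F).tangent (tangentMap 𝓘(ℝ, E) 𝓘(ℝ, F) p) w Y) := by
  let q : TangentBundle 𝓘(ℝ, E) M → ℝ := fun w =>
    (2 * m.inner w.proj (generator E g w.proj) (generator E g w.proj))⁻¹
  have hq : ContMDiffAt 𝓘(ℝ, E).tangent 𝓘(ℝ, ℝ) ∞ q w :=
    (contMDiffAt_const.mul ((contMDiff_inner_generator m hp).contMDiffAt.comp w
      contMDiff_proj_tangentBundle.contMDiffAt)).inv₀
      (mul_ne_zero two_ne_zero (inner_generator_pos m hp w.proj).ne')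
  obtain ⟨q', hq'⟩ : ∃ q' : E × E →L[ℝ] ℝ, HasMFDerivAt 𝓘(ℝ, E).tangent 𝓘(ℝ, ℝ) q w q' :=
    ⟨_, (hq.mdifferentiableAt (by simp)).hasMFDerivAt⟩
  obtain ⟨j, hj⟩ : ∃ j : E × E →L[ℝ] ℝ,
      diffAt 𝓘(ℝ, E).tangent (momentum m g) w = j := ⟨_, rfl⟩
  have hJ : HasMFDerivAt 𝓘(ℝ, E).tangent 𝓘(ℝ, ℝ) (momentum m g) w j := hj ▸ ((contMDiff_momentum m hp).contMDiffAt (x := w) |>.mdifferentiableAt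
    (by simp)).hasMFDerivAt
  have hH' : HasMFDerivAt 𝓘(ℝ, E).tangent 𝓘(ℝ, ℝ)
      (totalEnergy m' V' ∘ tangentMap 𝓘(ℝ, E) 𝓘(ℝ, F) p) w _ :=
    HasMFDerivAt.comp w
      ((contMDiff_totalEnergy m' hV's).contMDiffAt.mdifferentiableAt (by simp)).hasMFDerivAt
      ((ContMDiffAt.tangentMap_infty (w := w)
        hp.smooth_proj.contMDiffAt).mdifferentiableAt (by simp)).hasMFDerivAt
  have h1 := hH'.add (((hJ.mul hJ).sub (hasMFDerivAt_const (k * k) w)).mul hq')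
  have h2 : totalEnergy m V = totalEnergy m' V' ∘ tangentMap 𝓘(ℝ, E) 𝓘(ℝ, F) p +
      (momentum m g * momentum m g - fun _ => k * k) * q := by
    funext w
    rw [totalEnergy_eq_add hp hm' hV' w, sq, sq]
    rfl
  rw [← h2] at h1
  have hJY : j Y = 0 := (congrArg (fun L : E × E →L[ℝ] ℝ => L Y) hj).symm.trans hY
  have hk : momentum m g w = k := hw
  refine (congrArg (fun L : E × E →L[ℝ] ℝ => L Y) h1.mfderiv).trans ?_
  change _ + ((momentum m g w * momentum m g w - k * k) * q' Y +
      q w * (momentum m g w * j Y + momentum m g w * j Y - 0)) = _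
  rw [hJY, hk, sub_self, zero_mul, mul_zero, add_zero, sub_zero, mul_zero, add_zero, add_zero]
  rfl

section
variable {V : M → ℝ} {V' : B → ℝ}
  (hm' : ∀ (x : M) (w₁ w₂ : TangentSpace 𝓘(ℝ, E) x),
    m'.inner (p x) (mfderiv 𝓘(ℝ, E) 𝓘(ℝ, F) p x w₁) (mfderiv 𝓘(ℝ, E) 𝓘(ℝ, F) p x w₂) =
      transverseForm m g x w₁ w₂)
  (hV' : ∀ x, V' (p x) = V x + k ^ 2 / (2 * m.inner x (generator E g x) (generator E g x)))
  (hV's : ContMDiff 𝓘(ℝ, F) 𝓘(ℝ, ℝ) ∞ V')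
  {σ' : DiffForm 𝓘(ℝ, F).tangent (TangentBundle 𝓘(ℝ, F) B) 2}
  (hσ' : ∀ w ∈ momentumLevel m g k, ∃ a : E × E →ₗ[ℝ] ℝ,
    IsReductionAt m g p w (σ' (tangentMap 𝓘(ℝ, E) 𝓘(ℝ, F) p w)) a)
include hm' hV' hV's hσ'

/-- Conservation of the momentum: with a vector `ξ` in the kernels of `T(Tp)` and of the differential
of the momentum, `σ(X, ξ)` is on the one hand `-dH(ξ) = 0`, on the other hand a nonzero multiple of
the derivative of the momentum along `X`. -/
theorem hamiltonianField_mem_levelTangentSpace (hp : IsPrincipalFlowBundle E F g p)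
    {X : ∀ w : TangentBundle 𝓘(ℝ, E) M, TangentSpace 𝓘(ℝ, E).tangent w}
    (hX : IsHamiltonianField 𝓘(ℝ, E).tangent (lagrangeTwoForm m) (totalEnergy m V) X)
    {w : TangentBundle 𝓘(ℝ, E) M} (hw : w ∈ momentumLevel m g k) :
    X w ∈ levelTangentSpace m g w := by
  obtain ⟨a, ha⟩ := hσ' w hw
  obtain ⟨ξ, h₁, h₂, h₃⟩ := (hp.linear_reduction w _ a ha).2.1
  have h4 := hX w ξ
  rw [ha, diffAt_totalEnergy hp hm' hV' hV's hw h₂, h₁, h₂, map_zero, neg_zero, zero_mul, sub_zero]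
    at h4
  have h5 : ∀ (η : (F × F) [⋀^Fin 2]→L[ℝ] ℝ) (u : F × F), η ![u, 0] = 0 := fun η u =>
    η.map_coord_zero (1 : Fin 2) rfl
  refine (mul_eq_zero.1 ?_).resolve_right h₃
  refine Eq.trans ?_ h4
  refine ((congrArg (fun c : ℝ => c + _) (h5 _ _)).trans (zero_add _)).symm

/-- Projecting the Hamiltonian field of the energy gives the Hamiltonian field of the reduced
energy, and nothing else is a reduced field as `Tp` maps the momentum level onto `T(B)`. -/
theorem isReducedField_iff (hp : IsPrincipalFlowBundle E F g p)
    (hnd : ∀ (z : TangentBundle 𝓘(ℝ, F) B) (u : TangentSpace 𝓘(ℝ, F).tangent z),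
      (∀ u', σ' z ![u, u'] = 0) → u = 0)
    {X : ∀ w : TangentBundle 𝓘(ℝ, E) M, TangentSpace 𝓘(ℝ, E).tangent w}
    (hX : IsHamiltonianField 𝓘(ℝ, E).tangent (lagrangeTwoForm m) (totalEnergy m V) X)
    {X' : ∀ z : TangentBundle 𝓘(ℝ, F) B, TangentSpace 𝓘(ℝ, F).tangent z}
    (hX' : IsHamiltonianField 𝓘(ℝ, F).tangent σ' (totalEnergy m' V') X')
    (Y : ∀ z : TangentBundle 𝓘(ℝ, F) B, TangentSpace 𝓘(ℝ, F).tangent z) :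
    IsReducedField m g p k X Y ↔ Y = X' := by
  have h0 : IsReducedField m g p k X X' := by
    intro w hw
    obtain ⟨a, ha⟩ := hσ' w hw
    refine eq_of_forall_apply_eq (E := F × F)
      (hnd (tangentMap 𝓘(ℝ, E) 𝓘(ℝ, F) p w)) fun z => ?_
    obtain ⟨Y, rfl, hY⟩ := (hp.linear_reduction w _ a ha).1 z 0
    have hXw : diffAt 𝓘(ℝ, E).tangent (momentum m g) w (X w) = 0 :=
      hamiltonianField_mem_levelTangentSpace hm' hV' hV's hσ' hp hX hw
    have h1 := ha (X w) Y
    rw [hXw, hY, zero_mul, zero_mul, sub_zero, add_zero, hX,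
      diffAt_totalEnergy hp hm' hV' hV's hw hY] at h1
    exact h1.symm.trans (hX' _ _).symm
  refine ⟨fun hY => funext fun z => ?_, fun h => h ▸ h0⟩
  obtain ⟨w, hw, rfl⟩ := hp.exists_mem_momentumLevel m k z
  rw [← hY w hw, h0 w hw]

end

end ReducedSystem

theorem theorem4
    {E : Type*} [NormedAddCommGroup E] [NormedSpace ℝ E] [FiniteDimensional ℝ E]
    {M : Type*} [TopologicalSpace M] [ChartedSpace E M] [IsManifold 𝓘(ℝ, E) ∞ M]
    {F : Type*} [NormedAddCommGroup F] [NormedSpace ℝ F] [FiniteDimensional ℝ F]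
    {B : Type*} [TopologicalSpace B] [ChartedSpace F B] [IsManifold 𝓘(ℝ, F) ∞ B]
    (m : RiemMetric E M) (V : M → ℝ) (hV : ContMDiff 𝓘(ℝ, E) 𝓘(ℝ, ℝ) ∞ V)
    (g : ℝ → M → M) (p : M → B) (hp : IsPrincipalFlowBundle E F g p)
    (hgm : PreservesMetric m g) (hgV : ∀ τ x, V (g τ x) = V x) (k : ℝ) :
    -- the momentum is regular
    (∀ w : TangentBundle 𝓘(ℝ, E) M, diffAt 𝓘(ℝ, E).tangent (momentum m g) w ≠ 0) ∧
    -- the natural system `X` on `T(M)`, which is tangent to the momentum level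
    ∃ X : (w : TangentBundle 𝓘(ℝ, E) M) → TangentSpace 𝓘(ℝ, E).tangent w,
      (∀ Y, IsHamiltonianField 𝓘(ℝ, E).tangent (lagrangeTwoForm m) (totalEnergy m V) Y ↔ Y = X) ∧
      IsSmoothField 𝓘(ℝ, E).tangent X ∧
      (∀ w ∈ momentumLevel m g k, X w ∈ levelTangentSpace m g w) ∧
    -- the reduced metric and the amended potential on `B`
    ∃ (m' : RiemMetric F B) (V' : B → ℝ),
      (∀ n, IsReducedMetric m g p n ↔ n = m') ∧
      (∀ W, IsAmendedPotential m V g p k W ↔ W = V') ∧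
      ContMDiff 𝓘(ℝ, F) 𝓘(ℝ, ℝ) ∞ V' ∧
    -- the reduced form, the reduced system and the reduced energy on `T(B)`
    ∃ (σ' : DiffForm 𝓘(ℝ, F).tangent (TangentBundle 𝓘(ℝ, F) B) 2)
      (X' : (z : TangentBundle 𝓘(ℝ, F) B) → TangentSpace 𝓘(ℝ, F).tangent z)
      (H' : TangentBundle 𝓘(ℝ, F) B → ℝ),
      (∀ α, IsReducedForm m g p k α ↔ α = σ') ∧
      (∀ Y, IsReducedField m g p k X Y ↔ Y = X') ∧
      (∀ h, IsReducedEnergy m V g p k h ↔ h = H') ∧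
      IsSmoothField 𝓘(ℝ, F).tangent X' ∧
      ContMDiff 𝓘(ℝ, F).tangent 𝓘(ℝ, ℝ) ∞ H' ∧
    -- the assertions
      DiffForm.IsSymplectic 𝓘(ℝ, F).tangent σ' ∧
      IsHamiltonianField 𝓘(ℝ, F).tangent σ' H' X' ∧
      (∀ z, H' z = kineticEnergy m' z + V' z.proj) := by
  obtain ⟨m', hm'⟩ := exists_reducedMetric hgm hp
  obtain ⟨V', hV', hV's⟩ := exists_amendedPotential hV hp hgm hgV k
  obtain ⟨σ', hsymp, hσ'⟩ := exists_reducedForm hp hgm hm' k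
  have hσ := lagrangeTwoForm_isSymplectic m
  obtain ⟨X, hX, hXs⟩ := exists_unique_hamiltonianField hσ.smooth hσ.nondegenerate
    (contMDiff_totalEnergy m hV)
  obtain ⟨X', hX', hX's⟩ := exists_unique_hamiltonianField hsymp.smooth hsymp.nondegenerate
    (contMDiff_totalEnergy m' hV's)
  have hXH := (hX X).2 rfl
  have hXH' := (hX' X').2 rfl
  refine ⟨fun w h0 => ?_, X, hX, hXs, fun w hw =>
    hamiltonianField_mem_levelTangentSpace hm' hV' hV's hσ' hp hXH hw, m', V',
    isReducedMetric_iff m hp hm', fun W => ⟨fun hW => funext fun b => ?_, fun h => h ▸ hV'⟩, hV's,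
    σ', X', totalEnergy m' V', isReducedForm_iff hp hσ',
    isReducedField_iff hm' hV' hV's hσ' hp hsymp.nondegenerate hXH hXH',
    fun h => ⟨fun hh => funext fun z => ?_, ?_⟩, hX's, contMDiff_totalEnergy m' hV's, hsymp, hXH',
    fun z => rfl⟩
  · -- Regularity at `w` is read off at the momentum level through `w`.
    obtain ⟨σ₁, -, hσ₁⟩ := exists_reducedForm hp hgm hm' (momentum m g w)
    obtain ⟨a, ha⟩ := hσ₁ w rfl
    obtain ⟨Y, -, hY⟩ := (hp.linear_reduction w _ a ha).1 0 1
    rw [h0] at hY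
    exact zero_ne_one hY
  · obtain ⟨x, rfl⟩ := hp.surjective b
    rw [hW, hV']
  all_goals
    have hH : ∀ w ∈ momentumLevel m g k, totalEnergy m V w =
        totalEnergy m' V' (tangentMap 𝓘(ℝ, E) 𝓘(ℝ, F) p w) := fun w hw => by
      have hw' : momentum m g w = k := hw
      rw [totalEnergy_eq_add hp hm' hV', hw', sub_self, zero_mul, add_zero]
  · obtain ⟨w, hw, rfl⟩ := hp.exists_mem_momentumLevel m k z
    rw [← hh w hw, hH w hw]
  · rintro rfl
    exact hH
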